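/- Let $\mathcal X,\mathcal Y$ be measurable spaces and let $\mathsf P_{X,Y}$ be a fixed probability measure on $\mathcal X\times\mathcal Y$ with marginals $\mathsf P_X$, $\mathsf P_Y$. For $m\le n$, consider testing, from the two datasets $(X_1,\dots,X_n)$ and $(Y_1,\dots,Y_m)$, - $\mathcal H_0$: all observations are independent, with $X_j\sim\mathsf P_X$ and $Y_i\sim\mathsf P_Y$, against - $\mathcal H_1$: for $\pi$ uniformly distributed on the injections $[m]\to[n]$, conditionally on $\pi$ the pairs $(X_{\pi(i)},Y_i)$, $1\le i\le m$, are i.i.d. with law $\mathsf P_{X,Y}$ and, independently of them, the $X_j$ with $j\notin\pi([m])$ are i.i.d. with law $\mathsf P_X$. Denote the corresponding laws of the data by $\mathbb P_0=\mathbb P_0^{(n,m)}$ and $\mathbb P_1=\mathbb P_1^{(n,m)}$. Let $\alpha\in(0,1]$ be fixed, and let the sample sizes be $n\to\infty$ and $m=\alpha n$ up to rounding; that is, they run through a sequence $(n_k,m_k)$ with $n_k\to\infty$, $m_k\le n_k$ and $|m_k-\alpha n_k|<1$ for all $k$ (so $m_k=n_k$ if $\alpha=1$). Strong detection is said to be possible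 if there are measurable rejection regions $A_k$ with $\mathbb P_0^{(n_k,m_k)}(A_k)\to0$ and $\mathbb P_1^{(n_k,m_k)}(A_k^{c})\to0$ as $k\to\infty$. Let $$I_{\chi^2}(X;Y)=\chi^2(\mathsf P_{X,Y}\,\|\,\mathsf P_X\otimes\mathsf P_Y)=\int\Big(\frac{d\mathsf P_{X,Y}}{d(\mathsf P_X\otimes\mathsf P_Y)}-1\Big)^2 d(\mathsf P_X\otimes\mathsf P_Y),$$ which is set to $\infty$ if $\mathsf P_{X,Y}$ is not absolutely continuous with respect to $\mathsf P_X\otimes\mathsf P_Y$, and let $$\rho(X;Y)=\sup\big\{\mathbb E_{\mathsf P_{X,Y}}[g(X)h(Y)]:\ \mathbb E[g(X)]=\mathbb E[h(Y)]=0,\ \mathbb E[g(X)^2]=\mathbb E[h(Y)^2]=1\big\}$$ be the maximal correlation, the supremum being over measurable $g:\mathcal X\to\mathbb R$ and $h:\mathcal Y\to\mathbb R$, with $\sup\emptyset=0$. **Theorem.** Strong detection is possible if and only if either $I_{\chi^2}(X;Y)=\infty$, or $\alpha=1$ and $\rho(X;Y)=1$. -/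

import Mathlib

open MeasureTheory Filter Topology
open scoped ENNReal

namespace BrokenSample

/-- The chi-square divergence `χ²(P‖Q) = ∫ (dP/dQ - 1)² dQ`, with values in `[0, ∞]`; it is `∞` when
`P` is not absolutely continuous with respect to `Q`. -/
noncomputable def chiSqDiv {Ω : Type*} [MeasurableSpace Ω] (P Q : Measure Ω) : ℝ≥0∞ :=
  open Classical in
  if P ≪ Q then ∫⁻ x, ENNReal.ofReal (((P.rnDeriv Q x).toReal - 1) ^ 2) ∂Q else ∞

/-- The chi-square information `χ²(P_{X,Y} ‖ P_X ⊗ P_Y)` of a joint law `P`. -/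
noncomputable def chiSqInfo {𝒳 𝒴 : Type*} [MeasurableSpace 𝒳] [MeasurableSpace 𝒴]
    (P : Measure (𝒳 × 𝒴)) : ℝ≥0∞ :=
  chiSqDiv P (P.fst.prod P.snd)

/-- The Hirschfeld-Gebelein-Rényi maximal correlation of a joint law `P`: the supremum of
`E[g(X) h(Y)]` over centered functions `g`, `h` of unit variance. If there is no such pair
(one of the two marginals is trivial), the value is `sSup ∅ = 0`. -/
noncomputable def maximalCorrelation {𝒳 𝒴 : Type*} [MeasurableSpace 𝒳] [MeasurableSpace 𝒴]
    (P : Measure (𝒳 × 𝒴)) : ℝ :=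
  sSup {c : ℝ | ∃ (g : 𝒳 → ℝ) (h : 𝒴 → ℝ),
    Measurable g ∧ Measurable h ∧ MemLp g 2 P.fst ∧ MemLp h 2 P.snd ∧
    ∫ x, g x ∂P.fst = 0 ∧ ∫ y, h y ∂P.snd = 0 ∧
    ∫ x, g x ^ 2 ∂P.fst = 1 ∧ ∫ y, h y ^ 2 ∂P.snd = 1 ∧
    c = ∫ p, g p.1 * h p.2 ∂P}

/-- The law of the two datasets `(X_1, …, X_n)`, `(Y_1, …, Y_m)` under the null hypothesis:
all entries are independent, `X_j ∼ P_X` and `Y_i ∼ P_Y`. -/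
noncomputable def nullLaw {𝒳 𝒴 : Type*} [MeasurableSpace 𝒳] [MeasurableSpace 𝒴]
    (P : Measure (𝒳 × 𝒴)) (n m : ℕ) : Measure ((Fin n → 𝒳) × (Fin m → 𝒴)) :=
  (Measure.pi fun _ : Fin n => P.fst).prod (Measure.pi fun _ : Fin m => P.snd)

/-- Assembles the two datasets from an injection `π : [m] → [n]`, the pairs
`w i = (X_{π(i)}, Y_i)`, and the unmatched entries `z j = X_j`, `j ∉ π([m])`. -/
noncomputable def assemble {𝒳 𝒴 : Type*} {n m : ℕ} (π : Fin m ↪ Fin n)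
    (d : (Fin m → 𝒳 × 𝒴) × ({j : Fin n // j ∉ Set.range π} → 𝒳)) :
    (Fin n → 𝒳) × (Fin m → 𝒴) :=
  open Classical in
  (fun j => if hj : j ∈ Set.range π then (d.1 hj.choose).1 else d.2 ⟨j, hj⟩, fun i => (d.1 i).2)

theorem assemble_fst_apply {𝒳 𝒴 : Type*} {n m : ℕ} (π : Fin m ↪ Fin n)
    (d : (Fin m → 𝒳 × 𝒴) × ({j : Fin n // j ∉ Set.range π} → 𝒳)) (i : Fin m) :
    (assemble π d).1 (π i) = (d.1 i).1 := by
  have hj : π i ∈ Set.range π := ⟨i, rfl⟩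
  have h : hj.choose = i := π.injective hj.choose_spec
  simp only [assemble]
  rw [dif_pos hj, h]

theorem measurable_assemble {𝒳 𝒴 : Type*} [MeasurableSpace 𝒳] [MeasurableSpace 𝒴] {n m : ℕ}
    (π : Fin m ↪ Fin n) : Measurable (assemble (𝒳 := 𝒳) (𝒴 := 𝒴) π) := by
  refine Measurable.prodMk (measurable_pi_lambda _ fun j => ?_) (by fun_prop)
  by_cases hj : j ∈ Set.range π
  · simp only [hj, dite_true]
    fun_prop
  · simp only [hj, dite_false]
    fun_prop

/-- The law of the two datasets under the alternative hypothesis, given the latent injection `π`: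
the pairs `(X_{π(i)}, Y_i)` are i.i.d. with law `P`, and, independently of them, the unmatched
`X_j` are i.i.d. with law `P_X`. -/
noncomputable def altLawGiven {𝒳 𝒴 : Type*} [MeasurableSpace 𝒳] [MeasurableSpace 𝒴]
    (P : Measure (𝒳 × 𝒴)) {n m : ℕ} (π : Fin m ↪ Fin n) :
    Measure ((Fin n → 𝒳) × (Fin m → 𝒴)) :=
  ((Measure.pi fun _ : Fin m => P).prod
    (Measure.pi fun _ : {j : Fin n // j ∉ Set.range π} => P.fst)).map (assemble π)

/-- The law of the two datasets under the alternative hypothesis, for `m ≤ n`: the mixture of the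
conditional laws over an injection `π : [m] → [n]` that is chosen uniformly at random. -/
noncomputable def altLaw {𝒳 𝒴 : Type*} [MeasurableSpace 𝒳] [MeasurableSpace 𝒴]
    (P : Measure (𝒳 × 𝒴)) (n m : ℕ) : Measure ((Fin n → 𝒳) × (Fin m → 𝒴)) :=
  (Fintype.card (Fin m ↪ Fin n) : ℝ≥0∞)⁻¹ • ∑ π : Fin m ↪ Fin n, altLawGiven P π

/-- Strong detection is possible along the sample sizes `(n k, m k)`: there are tests, given by
measurable rejection regions `A k`, whose Type-I and Type-II error probabilities both vanish. -/
def StrongDetection {𝒳 𝒴 : Type*} [MeasurableSpace 𝒳] [MeasurableSpace 𝒴]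
    (P : Measure (𝒳 × 𝒴)) (n m : ℕ → ℕ) : Prop :=
  ∃ A : ∀ k : ℕ, Set ((Fin (n k) → 𝒳) × (Fin (m k) → 𝒴)),
    (∀ k, MeasurableSet (A k)) ∧
    Tendsto (fun k => nullLaw P (n k) (m k) (A k)) atTop (𝓝 0) ∧
    Tendsto (fun k => altLaw P (n k) (m k) (A k)ᶜ) atTop (𝓝 0)

end BrokenSample

/-! Write Q for the product of the marginals. Drawing n i.i.d. pairs and keeping only the second
entries with index in the range of π gives the alternative given π when the pairs have law P, and
the null law when they have law Q. Both hypotheses can thus be studied through i.i.d. pairs.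

Infinite information. By duality, infinite χ² yields bounded functions g, centered in each variable,
with E_P[g]² / E_Q[g²] as large as desired (`exists_signal_of_chiSqInfo_eq_top`). The sum of g over
all nm pairs has mean 0 under the null and m E_P[g] under the alternative. By double centering, its
terms are uncorrelated except for a term with itself or with its mirror image, so the variance is
O(m + nm E_Q[g²]) in both cases (`integral_pairSum_sub_sq_le`). As m is of order n, Chebyshev's
inequality separates the two hypotheses.

Maximal correlation one with m = n. Take normalized g, h with correlation c close to 1. The
statistic ∑ g(X_j) - ∑ h(Y_i) does not depend on the matching. Its variance is n(2 - 2c) under the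
alternative and 2n under the null, where the central limit theorem shows that values small compared
with √n are unlikely (`eventually_measure_abs_sum_le`).

Impossibility. If χ² is finite, P has density 1 + K with respect to Q, with K square integrable and
doubly centered. Expanding the product of the densities over subsets of the Y-indices and averaging
over π gives an orthogonal decomposition of the likelihood ratio, and its second moment becomes a
weighted sum of E[perm(K(X_i, Y_j))²] over s × s matrices (`integral_likelihoodRatio_sq`). Expand a
permanent along one Y-entry: coinciding X-entries contribute I = E_Q[K²], and distinct ones at most
r, the squared norm of the integral operator of K, itself bounded by ρ²
(`integral_kernelPermanent_succ_sq_le`, `integral_sq_integral_kernel_le`). If m ≤ βn, the second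
moment is therefore at most a binomial-type series whose successive ratios tend to βr. For βr < 1 it
stays bounded, so events that are asymptotically null under the null law cannot have probability
tending to one under the alternative. For α < 1 one takes β between α and 1 and uses ρ ≤ 1; for α =
1 one takes β = 1 and needs ρ < 1. -/

namespace BrokenSample

/-! ### Reindexing and resampling coordinates of product measures -/

section ProductMeasures

/-- Reindexing a product of copies of one probability measure along an injection. -/
theorem measurePreserving_comp_injective {ι κ Ω : Type*} [Fintype ι] [Fintype κ]
    [MeasurableSpace Ω] (μ : Measure Ω) [IsProbabilityMeasure μ] {e : κ → ι}
    (he : Function.Injective e) :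
    MeasurePreserving (fun x : ι → Ω => x ∘ e) (Measure.pi fun _ => μ)
      (Measure.pi fun _ => μ) := by
  refine ⟨by fun_prop, ?_⟩
  have h : ProbabilityTheory.iIndepFun (fun (i : ι) (x : ι → Ω) => x i)
      (Measure.pi fun _ => μ) :=
    ProbabilityTheory.iIndepFun_pi (X := fun _ x => x) fun _ => aemeasurable_id
  have h2 := (ProbabilityTheory.iIndepFun_iff_map_fun_eq_pi_map
    (fun i => (measurable_pi_apply _).aemeasurable)).1 (h.precomp he)
  refine h2.trans ?_
  congr 1
  funext k
  exact (measurePreserving_eval (fun _ : ι => μ) (e k)).map_eq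

/-- Resampling one coordinate preserves a product measure. -/
theorem measurePreserving_update {ι Ω : Type*} [Fintype ι] [DecidableEq ι]
    [MeasurableSpace Ω] (μ : Measure Ω) [IsProbabilityMeasure μ] (j : ι) :
    MeasurePreserving (fun p : (ι → Ω) × Ω => Function.update p.1 j p.2)
      ((Measure.pi fun _ => μ).prod μ) (Measure.pi fun _ => μ) := by
  have hm : Measurable (fun p : (ι → Ω) × Ω => Function.update p.1 j p.2) :=
    measurable_update'
  refine ⟨hm, (Measure.pi_eq fun s hs => ?_).symm⟩
  rw [Measure.map_apply hm (MeasurableSet.univ_pi hs)]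
  have : (fun p : (ι → Ω) × Ω => Function.update p.1 j p.2) ⁻¹' Set.univ.pi s =
      (Set.univ.pi (Function.update s j Set.univ)) ×ˢ s j := by
    ext ⟨x, u⟩
    simp only [Set.mem_preimage, Set.mem_pi, Set.mem_univ, true_imp_iff, Set.mem_prod]
    constructor
    · intro h
      refine ⟨fun i => ?_, by simpa using h j⟩
      by_cases hi : i = j
      · subst hi; simp
      · simpa [hi] using h i
    · rintro ⟨h1, h2⟩ i
      by_cases hi : i = j
      · subst hi; simpa using h2
      · simpa [hi] using h1 i
  rw [this, Measure.prod_prod, Measure.pi_pi, ← Finset.prod_erase_mul _ _ (Finset.mem_univ j),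
    ← Finset.prod_erase_mul (Finset.univ) (fun i => μ (s i)) (Finset.mem_univ j)]
  simp only [Function.update_self, measure_univ, mul_one]
  congr 1
  refine Finset.prod_congr rfl fun i hi => ?_
  rw [Function.update_of_ne (Finset.ne_of_mem_erase hi)]

/-- A function whose integral over one coordinate vanishes identically has integral zero. -/
theorem integral_pi_eq_zero_of_update {ι Ω : Type*} [Fintype ι] [DecidableEq ι]
    [MeasurableSpace Ω] (μ : Measure Ω) [IsProbabilityMeasure μ] (j : ι) {F : (ι → Ω) → ℝ}
    (hF : ∀ x, ∫ u, F (Function.update x j u) ∂μ = 0) :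
    ∫ x, F x ∂(Measure.pi fun _ => μ) = 0 := by
  by_cases hi : Integrable F (Measure.pi fun _ => μ)
  · have mp := measurePreserving_update μ j
    have h1 := mp.integrable_comp_of_integrable hi
    rw [← mp.map_eq, integral_map mp.measurable.aemeasurable
      (by rw [mp.map_eq]; exact hi.aestronglyMeasurable)]
    refine (integral_prod _ h1).trans ?_
    simp [hF]
  · exact integral_undef hi

end ProductMeasures

/-! ### The null and alternative laws as images of i.i.d. pairs -/

section Laws

variable {𝒳 𝒴 : Type*} [MeasurableSpace 𝒳] [MeasurableSpace 𝒴]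

/-- Reads off the two datasets from `n` pairs, of which only those second coordinates are kept
whose index is in the range of `π`. -/
def observe {n m : ℕ} (π : Fin m ↪ Fin n) (p : Fin n → 𝒳 × 𝒴) :
    (Fin n → 𝒳) × (Fin m → 𝒴) :=
  (fun j => (p j).1, fun i => (p (π i)).2)

theorem measurable_observe {n m : ℕ} (π : Fin m ↪ Fin n) :
    Measurable (observe (𝒳 := 𝒳) (𝒴 := 𝒴) π) := by
  unfold observe; fun_prop

/-- An unmatched X-entry may be viewed as the first half of a pair whose second half is discarded.
This puts all injections on one probability space of i.i.d. pairs. -/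
theorem altLawGiven_eq_map_observe (P : Measure (𝒳 × 𝒴)) [IsProbabilityMeasure P] {n m : ℕ}
    (π : Fin m ↪ Fin n) :
    altLawGiven P π = (Measure.pi fun _ : Fin n => P).map (observe π) := by
  classical
  have h1 : MeasurePreserving (MeasurableEquiv.piEquivPiSubtypeProd (fun _ : Fin n => 𝒳 × 𝒴)
      (fun j => j ∈ Set.range π)) (Measure.pi fun _ => P)
      ((Measure.pi fun _ : {j : Fin n // j ∈ Set.range π} => P).prod
        (Measure.pi fun _ : {j : Fin n // j ∉ Set.range π} => P)) := by
    convert measurePreserving_piEquivPiSubtypeProd (fun _ : Fin n => P)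
      (fun j => j ∈ Set.range π)
  have h2 : MeasurePreserving
      (fun x : {j : Fin n // j ∈ Set.range π} → 𝒳 × 𝒴 =>
        x ∘ (fun i : Fin m => ⟨π i, i, rfl⟩))
      (Measure.pi fun _ => P) (Measure.pi fun _ => P) :=
    measurePreserving_comp_injective P fun a b hab => π.injective (congrArg Subtype.val hab)
  have h3 : MeasurePreserving
      (fun (x : {j : Fin n // j ∉ Set.range π} → 𝒳 × 𝒴) j => (x j).1)
      (Measure.pi fun _ => P) (Measure.pi fun _ => P.fst) :=
    measurePreserving_pi _ _ fun _ => ⟨measurable_fst, rfl⟩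
  have h4 := (h2.prod h3).comp h1
  rw [altLawGiven, ← h4.map_eq, Measure.map_map (measurable_assemble π) h4.measurable]
  congr 1
  funext p
  refine Prod.ext (funext fun j => ?_) (funext fun i => rfl)
  simp only [Function.comp_apply, assemble, observe]
  split_ifs with hj
  · have := hj.choose_spec
    change (p (π hj.choose)).1 = _
    rw [this]
  · rfl

theorem nullLaw_eq_map_observe (P : Measure (𝒳 × 𝒴)) [IsProbabilityMeasure P] {n m : ℕ}
    (π : Fin m ↪ Fin n) :
    nullLaw P n m = (Measure.pi fun _ : Fin n => P.fst.prod P.snd).map (observe π) := by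
  have h1 := measurePreserving_arrowProdEquivProdArrow 𝒳 𝒴 (Fin n) (fun _ => P.fst)
    (fun _ => P.snd)
  have h2 := (MeasurePreserving.id (Measure.pi fun _ : Fin n => P.fst)).prod
    (measurePreserving_comp_injective P.snd π.injective)
  have h3 := h2.comp h1
  rw [nullLaw, ← h3.map_eq]
  rfl

/-- Serves to carry densities over: both laws become images under the same map `assemble π`. -/
theorem altLawGiven_prod_eq_nullLaw (P : Measure (𝒳 × 𝒴)) [IsProbabilityMeasure P] {n m : ℕ}
    (π : Fin m ↪ Fin n) : altLawGiven (P.fst.prod P.snd) π = nullLaw P n m := by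
  rw [altLawGiven_eq_map_observe, nullLaw_eq_map_observe P π]

instance (P : Measure (𝒳 × 𝒴)) [IsProbabilityMeasure P] {n m : ℕ} :
    IsProbabilityMeasure (nullLaw P n m) := by
  unfold nullLaw; infer_instance

instance (P : Measure (𝒳 × 𝒴)) [IsProbabilityMeasure P] {n m : ℕ} (π : Fin m ↪ Fin n) :
    IsProbabilityMeasure (altLawGiven P π) := by
  rw [altLawGiven_eq_map_observe]
  exact Measure.isProbabilityMeasure_map (measurable_observe π).aemeasurable

theorem card_embedding_ne_zero {n m : ℕ} (h : m ≤ n) : Fintype.card (Fin m ↪ Fin n) ≠ 0 :=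
  have : Nonempty (Fin m ↪ Fin n) := ⟨Fin.castLEEmb h⟩
  Fintype.card_ne_zero

/-- A bound that holds given every injection holds for the mixture. -/
theorem altLaw_apply_le (P : Measure (𝒳 × 𝒴)) {n m : ℕ} (h : m ≤ n)
    (A : Set ((Fin n → 𝒳) × (Fin m → 𝒴))) {c : ℝ≥0∞}
    (hc : ∀ π : Fin m ↪ Fin n, altLawGiven P π A ≤ c) : altLaw P n m A ≤ c := by
  rw [altLaw, Measure.smul_apply, Measure.finsetSum_apply, smul_eq_mul]
  calc _ ≤ (Fintype.card (Fin m ↪ Fin n) : ℝ≥0∞)⁻¹ * ∑ _π : Fin m ↪ Fin n, c := by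
        gcongr with π; exact hc π
    _ = c := by
        rw [Finset.sum_const, Finset.card_univ, nsmul_eq_mul, ← mul_assoc,
          ENNReal.inv_mul_cancel (by exact_mod_cast card_embedding_ne_zero h) (by simp), one_mul]

theorem isProbabilityMeasure_altLaw (P : Measure (𝒳 × 𝒴)) [IsProbabilityMeasure P] {n m : ℕ}
    (h : m ≤ n) : IsProbabilityMeasure (altLaw P n m) := by
  refine ⟨?_⟩
  rw [altLaw, Measure.smul_apply, Measure.finsetSum_apply, smul_eq_mul]
  simp only [measure_univ, Finset.sum_const, Finset.card_univ, nsmul_eq_mul, mul_one]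
  exact ENNReal.inv_mul_cancel (by exact_mod_cast card_embedding_ne_zero h) (by simp)

/-- Strong detection is possible as soon as both error probabilities can eventually be made
smaller than any given threshold. -/
theorem strongDetection_of_forall_eventually (P : Measure (𝒳 × 𝒴)) (n m : ℕ → ℕ)
    (h : ∀ ε : ℝ≥0∞, 0 < ε → ∀ᶠ k in atTop, ∃ A : Set ((Fin (n k) → 𝒳) × (Fin (m k) → 𝒴)),
      MeasurableSet A ∧ nullLaw P (n k) (m k) A ≤ ε ∧ altLaw P (n k) (m k) Aᶜ ≤ ε) :
    StrongDetection P n m := by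
  -- `E k` is the optimal worst-case error. It tends to 0 by hypothesis, and a region within 1/(k+1)
  -- of the optimum is chosen for every k, so no diagonal sequence in ε is needed.
  let e : ∀ k, Set ((Fin (n k) → 𝒳) × (Fin (m k) → 𝒴)) → ℝ≥0∞ := fun k A =>
    max (nullLaw P (n k) (m k) A) (altLaw P (n k) (m k) Aᶜ)
  let E : ℕ → ℝ≥0∞ := fun k => ⨅ A : {A // MeasurableSet A}, e k A.1
  have hA : ∀ k : ℕ, ∃ A : {A // MeasurableSet A}, e k A.1 ≤ E k + (k + 1 : ℝ≥0∞)⁻¹ := by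
    intro k
    by_cases hE : E k = ∞
    · exact ⟨⟨∅, MeasurableSet.empty⟩, by simp [hE]⟩
    · have : E k < E k + (k + 1 : ℝ≥0∞)⁻¹ := ENNReal.lt_add_right hE (by simp)
      obtain ⟨A, hA⟩ := iInf_lt_iff.1 this
      exact ⟨A, hA.le⟩
  choose A hA using hA
  have hE : Tendsto E atTop (𝓝 0) := by
    rw [ENNReal.tendsto_nhds_zero]
    intro ε hε
    filter_upwards [h ε hε] with k ⟨B, hB, h1, h2⟩
    exact (iInf_le _ ⟨B, hB⟩).trans (max_le h1 h2)
  have hinv : Tendsto (fun k : ℕ => (k + 1 : ℝ≥0∞)⁻¹) atTop (𝓝 0) := by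
    have := ENNReal.tendsto_inv_nat_nhds_zero.comp (tendsto_add_atTop_nat 1)
    simpa [Function.comp_def] using this
  have hsum : Tendsto (fun k => E k + (k + 1 : ℝ≥0∞)⁻¹) atTop (𝓝 0) := by
    simpa using hE.add hinv
  refine ⟨fun k => (A k).1, fun k => (A k).2, ?_, ?_⟩
  · exact tendsto_of_tendsto_of_tendsto_of_le_of_le tendsto_const_nhds hsum
      (fun _ => zero_le) fun k => (le_max_left _ _).trans (hA k)
  · exact tendsto_of_tendsto_of_tendsto_of_le_of_le tendsto_const_nhds hsum
      (fun _ => zero_le) fun k => (le_max_right _ _).trans (hA k)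

end Laws

/-- Chebyshev's inequality for the second moment. -/
theorem measure_le_abs_le_ofReal {Ω : Type*} [MeasurableSpace Ω] (M : Measure Ω)
    [IsFiniteMeasure M] {S : Ω → ℝ} (hS : Integrable (fun ω => S ω ^ 2) M) {a v : ℝ} (ha : 0 < a)
    (hv : ∫ ω, S ω ^ 2 ∂M ≤ v) : M {ω | a ≤ |S ω|} ≤ ENNReal.ofReal (v / a ^ 2) := by
  have h := mul_meas_ge_le_integral_of_nonneg (ae_of_all M fun ω => sq_nonneg (S ω)) hS (a ^ 2)
  have hset : {ω | a ^ 2 ≤ S ω ^ 2} = {ω | a ≤ |S ω|} := by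
    ext ω
    rw [Set.mem_ofPred_eq, Set.mem_ofPred_eq, sq_le_sq, abs_of_pos ha]
  rw [hset] at h
  rw [← ENNReal.ofReal_toReal (measure_ne_top M {ω | a ≤ |S ω|})]
  refine ENNReal.ofReal_le_ofReal ?_
  rw [le_div_iff₀ (by positivity), mul_comm]
  exact h.trans hv

/-! ### Variance of the sum of a doubly centered function over all pairs -/

section PairStatistic

variable {𝒳 𝒴 : Type*}

/-- The statistic that sums a function over all pairs of an `X`- and a `Y`-observation. -/
def pairSum {n m : ℕ} (f : 𝒳 × 𝒴 → ℝ) (d : (Fin n → 𝒳) × (Fin m → 𝒴)) : ℝ :=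
  ∑ q : Fin n × Fin m, f (d.1 q.1, d.2 q.2)

/-- The value of `f` at the first entry of pair `j` and the second entry of pair `k`, centered. -/
def crossTerm {n : ℕ} (f : 𝒳 × 𝒴 → ℝ) (e : ℝ) (j k : Fin n) (p : Fin n → 𝒳 × 𝒴) : ℝ :=
  f ((p j).1, (p k).2) - if j = k then e else 0

theorem abs_crossTerm_le {n : ℕ} {f : 𝒳 × 𝒴 → ℝ} {B e : ℝ} (hB : ∀ z, |f z| ≤ B) (he : |e| ≤ B)
    (j k : Fin n) (p : Fin n → 𝒳 × 𝒴) : |crossTerm f e j k p| ≤ 2 * B := by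
  unfold crossTerm
  have h1 := hB ((p j).1, (p k).2)
  have h2 : |(if j = k then e else 0)| ≤ B := by
    split_ifs
    · exact he
    · simpa using (abs_nonneg e).trans he
  exact (abs_sub _ _).trans (by linarith)

theorem crossTerm_update_of_ne (f : 𝒳 × 𝒴 → ℝ) (e : ℝ) {n : ℕ} {j k c : Fin n} (hj : c ≠ j)
    (hk : c ≠ k) (p : Fin n → 𝒳 × 𝒴) (u : 𝒳 × 𝒴) :
    crossTerm f e j k (Function.update p c u) = crossTerm f e j k p := by
  simp [crossTerm, Function.update_of_ne hj.symm, Function.update_of_ne hk.symm]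

variable [MeasurableSpace 𝒳] [MeasurableSpace 𝒴]

theorem measurable_pairSum {n m : ℕ} {f : 𝒳 × 𝒴 → ℝ} (hf : Measurable f) :
    Measurable (pairSum (n := n) (m := m) f) := by
  unfold pairSum; fun_prop

theorem measurable_crossTerm {n : ℕ} {f : 𝒳 × 𝒴 → ℝ} (hf : Measurable f) (e : ℝ) (j k : Fin n) :
    Measurable (crossTerm f e j k) := by
  unfold crossTerm; fun_prop

variable (P : Measure (𝒳 × 𝒴)) [IsProbabilityMeasure P] {f : 𝒳 × 𝒴 → ℝ} {B : ℝ}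

/-- If j = k, the subtracted mean centers the term. If j ≠ k, the resampled pair enters through only
one of its coordinates, so its marginal law is what counts and the centering of f in that variable
applies. -/
theorem integral_update_crossTerm (hf : Measurable f) (hB : ∀ z, |f z| ≤ B)
    (hX : ∀ y, ∫ x, f (x, y) ∂P.fst = 0) (hY : ∀ x, ∫ y, f (x, y) ∂P.snd = 0)
    {n : ℕ} {j k c : Fin n} (hc : c = j ∨ c = k) (p : Fin n → 𝒳 × 𝒴) :
    ∫ u, crossTerm f (∫ z, f z ∂P) j k (Function.update p c u) ∂P = 0 := by
  unfold crossTerm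
  by_cases hjk : j = k
  · subst hjk
    obtain rfl : c = j := by tauto
    have hi : Integrable f P := Integrable.of_bound hf.aestronglyMeasurable B (ae_of_all _ hB)
    simp [integral_sub hi (integrable_const _)]
  · simp only [hjk, if_false, sub_zero]
    rcases hc with rfl | rfl
    · simp only [Function.update_self, Function.update_of_ne (Ne.symm hjk)]
      rw [← hX (p k).2, Measure.fst, integral_map measurable_fst.aemeasurable
        (f := fun x => f (x, (p k).2))
        (hf.comp (measurable_id.prodMk measurable_const)).aestronglyMeasurable]
    · simp only [Function.update_self, Function.update_of_ne hjk]
      rw [← hY (p j).1, Measure.snd, integral_map measurable_snd.aemeasurable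
        (f := fun y => f ((p j).1, y))
        (hf.comp (measurable_const.prodMk measurable_id)).aestronglyMeasurable]

theorem integral_crossTerm_mul_of_notMem (hf : Measurable f) (hB : ∀ z, |f z| ≤ B)
    (hX : ∀ y, ∫ x, f (x, y) ∂P.fst = 0) (hY : ∀ x, ∫ y, f (x, y) ∂P.snd = 0)
    {n : ℕ} {j k j' k' c : Fin n} (hc : c = j ∨ c = k) (hj : c ≠ j') (hk : c ≠ k') :
    ∫ p, crossTerm f (∫ z, f z ∂P) j k p * crossTerm f (∫ z, f z ∂P) j' k' p
      ∂(Measure.pi fun _ => P) = 0 := by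
  refine integral_pi_eq_zero_of_update P c fun p => ?_
  simp only [crossTerm_update_of_ne f _ hj hk]
  rw [integral_mul_const, integral_update_crossTerm P hf hB hX hY hc, zero_mul]

/-- If an index occurs in only one factor, resampling that pair annihilates the product. Otherwise
{j, k} = {j', k'}, and the two excluded cases are the identical and the swapped term; the latter can
correlate because each pair is dependent. -/
theorem integral_crossTerm_mul_eq_zero (hf : Measurable f) (hB : ∀ z, |f z| ≤ B)
    (hX : ∀ y, ∫ x, f (x, y) ∂P.fst = 0) (hY : ∀ x, ∫ y, f (x, y) ∂P.snd = 0)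
    {n : ℕ} {j k j' k' : Fin n} (h1 : ¬ (j = j' ∧ k = k')) (h2 : ¬ (j = k' ∧ j' = k)) :
    ∫ p, crossTerm f (∫ z, f z ∂P) j k p * crossTerm f (∫ z, f z ∂P) j' k' p
      ∂(Measure.pi fun _ => P) = 0 := by
  by_cases hc : ∃ c, (c = j ∨ c = k) ∧ c ≠ j' ∧ c ≠ k'
  · obtain ⟨c, hc, hj, hk⟩ := hc
    exact integral_crossTerm_mul_of_notMem P hf hB hX hY hc hj hk
  by_cases hc' : ∃ c, (c = j' ∨ c = k') ∧ c ≠ j ∧ c ≠ k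
  · obtain ⟨c, hc, hj, hk⟩ := hc'
    simp_rw [mul_comm (crossTerm f _ j k _)]
    exact integral_crossTerm_mul_of_notMem P hf hB hX hY hc hj hk
  · exfalso
    push Not at hc hc'
    have a1 := hc j (Or.inl rfl)
    have a2 := hc k (Or.inr rfl)
    have a3 := hc' j' (Or.inl rfl)
    have a4 := hc' k' (Or.inr rfl)
    grind

theorem measurePreserving_cross {n : ℕ} {j k : Fin n} (h : j ≠ k) :
    MeasurePreserving (fun p : Fin n → 𝒳 × 𝒴 => ((p j).1, (p k).2)) (Measure.pi fun _ => P)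
      (P.fst.prod P.snd) := by
  refine ⟨by fun_prop, ?_⟩
  have hi : ProbabilityTheory.iIndepFun (fun (i : Fin n) (p : Fin n → 𝒳 × 𝒴) => p i)
      (Measure.pi fun _ => P) :=
    ProbabilityTheory.iIndepFun_pi (X := fun _ x => x) fun _ => aemeasurable_id
  have h2 := (hi.indepFun h).comp measurable_fst measurable_snd
  rw [ProbabilityTheory.indepFun_iff_map_prod_eq_prod_map_map
    (measurable_fst.comp (measurable_pi_apply j)).aemeasurable
    (measurable_snd.comp (measurable_pi_apply k)).aemeasurable] at h2
  refine h2.trans ?_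
  rw [← Measure.map_map measurable_fst (measurable_pi_apply j),
    ← Measure.map_map measurable_snd (measurable_pi_apply k)]
  have e (i : Fin n) := (measurePreserving_eval (fun _ : Fin n => P) i).map_eq
  change (Measure.map (Function.eval j) (Measure.pi fun _ : Fin n => P)).fst.prod
    (Measure.snd (Measure.map (Function.eval k) (Measure.pi fun _ : Fin n => P))) = _
  rw [e j, e k]

/-- Off the diagonal the two entries are independent. On the diagonal they have law P, under which
the second moment of f is not controlled by the one under the product law; the crude bound suffices,
as the pair statistic has only m such terms. -/
theorem integral_crossTerm_sq_le (hf : Measurable f) (hB : ∀ z, |f z| ≤ B) {n : ℕ}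
    (j k : Fin n) :
    ∫ p, crossTerm f (∫ z, f z ∂P) j k p ^ 2 ∂(Measure.pi fun _ => P) ≤
      (if j = k then 4 * B ^ 2 else 0) + ∫ z, f z ^ 2 ∂(P.fst.prod P.snd) := by
  have hv : 0 ≤ ∫ z, f z ^ 2 ∂(P.fst.prod P.snd) := integral_nonneg fun z => sq_nonneg _
  have he : |∫ z, f z ∂P| ≤ B := by
    simpa using norm_integral_le_of_norm_le_const (μ := P) (f := f) (ae_of_all _ hB)
  by_cases hjk : j = k
  · rw [if_pos hjk]
    have h1 : ∀ p : Fin n → 𝒳 × 𝒴, crossTerm f (∫ z, f z ∂P) j k p ^ 2 ≤ 4 * B ^ 2 := fun p => by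
      have h := abs_crossTerm_le hB he j k p
      have := abs_le.1 h
      nlinarith
    have h2 : ∫ p, crossTerm f (∫ z, f z ∂P) j k p ^ 2 ∂(Measure.pi fun _ => P) ≤
        ∫ _p, 4 * B ^ 2 ∂(Measure.pi fun _ : Fin n => P) :=
      integral_mono_of_nonneg (ae_of_all _ fun p => sq_nonneg _) (integrable_const _)
        (ae_of_all _ h1)
    simp only [integral_const, probReal_univ, one_smul] at h2
    linarith
  · rw [if_neg hjk, zero_add, ← (measurePreserving_cross P hjk).map_eq,
      integral_map (by fun_prop) (by fun_prop)]
    simp [crossTerm, hjk]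

/-- The variance bound for the pair statistic, valid both for dependent and independent pairs. -/
theorem integral_pairSum_sub_sq_le (hf : Measurable f) (hB : ∀ z, |f z| ≤ B)
    (hX : ∀ y, ∫ x, f (x, y) ∂P.fst = 0) (hY : ∀ x, ∫ y, f (x, y) ∂P.snd = 0)
    {n m : ℕ} (π : Fin m ↪ Fin n) :
    ∫ p, (pairSum f (observe π p) - m * ∫ z, f z ∂P) ^ 2 ∂(Measure.pi fun _ => P) ≤
      2 * (m * (4 * B ^ 2) + n * m * ∫ z, f z ^ 2 ∂(P.fst.prod P.snd)) := by
  set e := ∫ z, f z ∂P with he_def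
  set v := ∫ z, f z ^ 2 ∂(P.fst.prod P.snd) with hv_def
  have hv : 0 ≤ v := integral_nonneg fun z => sq_nonneg _
  have he : |e| ≤ B := by
    simpa using norm_integral_le_of_norm_le_const (μ := P) (f := f) (ae_of_all _ hB)
  let g : Fin n × Fin m → (Fin n → 𝒳 × 𝒴) → ℝ := fun q => crossTerm f e q.1 (π q.2)
  let c : Fin n × Fin m → ℝ := fun q => (if q.1 = π q.2 then 4 * B ^ 2 else 0) + v
  have hc0 : ∀ q, 0 ≤ c q := fun q => add_nonneg (by split_ifs <;> positivity) hv
  have hg2 : ∀ q, ∫ p, g q p ^ 2 ∂(Measure.pi fun _ => P) ≤ c q := fun q =>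
    integral_crossTerm_sq_le P hf hB q.1 (π q.2)
  have hcount (b : ℝ) : ∑ q : Fin n × Fin m, (if q.1 = π q.2 then b else 0) = m * b := by
    rw [Fintype.sum_prod_type_right]
    simp
  have hsum : ∀ p, pairSum f (observe π p) - m * e = ∑ q, g q p := fun p => by
    simp only [g, crossTerm, Finset.sum_sub_distrib, hcount]
    rfl
  have hmeas : ∀ q, Measurable (g q) := fun q => measurable_crossTerm hf e _ _
  have hint : ∀ q q', Integrable (fun p => g q p * g q' p) (Measure.pi fun _ => P) :=
    fun q q' => Integrable.of_bound (((hmeas q).mul (hmeas q')).aestronglyMeasurable)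
      (2 * B * (2 * B)) (ae_of_all _ fun p => by
        rw [norm_mul]
        exact mul_le_mul (abs_crossTerm_le hB he _ _ _) (abs_crossTerm_le hB he _ _ _)
          (norm_nonneg _) (by linarith [(abs_nonneg e).trans he]))
  -- Only q' = q and the mirror image of q survive. The mirror product is bounded by the mean of the
  -- two squares, which have the same bound `c q`; this produces the factor 2.
  have hpair : ∀ q q', ∫ p, g q p * g q' p ∂(Measure.pi fun _ => P) ≤
      (if q' = q then c q else 0) + (if q.1 = π q'.2 ∧ q'.1 = π q.2 then c q else 0) := by
    intro q q'
    by_cases h1 : q' = q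
    · subst h1
      rw [if_pos rfl]
      have := hg2 q'
      simp only [pow_two] at this
      have h3 : 0 ≤ (if q'.1 = π q'.2 ∧ q'.1 = π q'.2 then c q' else 0) := by
        split_ifs
        · exact hc0 _
        · exact le_rfl
      linarith
    by_cases h2 : q.1 = π q'.2 ∧ q'.1 = π q.2
    · rw [if_neg h1, if_pos h2, zero_add]
      have hcq : c q' = c q := by
        simp only [c, h2.1, h2.2]
        congr 2
        exact propext eq_comm
      have hle : ∫ p, g q p * g q' p ∂(Measure.pi fun _ => P) ≤
          ∫ p, (g q p ^ 2 / 2 + g q' p ^ 2 / 2) ∂(Measure.pi fun _ => P) := by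
        refine integral_mono (hint q q') ?_ fun p => ?_
        · simp only [pow_two]
          exact ((hint q q).div_const 2).add ((hint q' q').div_const 2)
        · simp only
          nlinarith [sq_nonneg (g q p - g q' p)]
      rw [integral_add (by simpa only [pow_two] using (hint q q).div_const 2)
        (by simpa only [pow_two] using (hint q' q').div_const 2), integral_div, integral_div] at hle
      have := hg2 q
      have := hg2 q'
      linarith
    · rw [if_neg h1, if_neg h2, add_zero]
      refine (integral_crossTerm_mul_eq_zero P hf hB hX hY ?_ h2).le
      rintro ⟨h3, h4⟩
      exact h1 (Prod.ext h3.symm (π.injective h4.symm))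
  have hswap : ∀ q : Fin n × Fin m, ∑ q' : Fin n × Fin m,
      (if q.1 = π q'.2 ∧ q'.1 = π q.2 then c q else 0) ≤ c q := by
    intro q
    rw [← Finset.sum_filter, Finset.sum_const, nsmul_eq_mul]
    have : (Finset.univ.filter fun q' : Fin n × Fin m =>
        q.1 = π q'.2 ∧ q'.1 = π q.2).card ≤ 1 := by
      rw [Finset.card_le_one]
      intro a ha b hb
      simp only [Finset.mem_filter, Finset.mem_univ, true_and] at ha hb
      exact Prod.ext (ha.2.trans hb.2.symm) (π.injective (ha.1.symm.trans hb.1))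
    calc _ ≤ ((1 : ℕ) : ℝ) * c q := by
          gcongr
      _ = c q := by simp
  calc ∫ p, (pairSum f (observe π p) - m * e) ^ 2 ∂(Measure.pi fun _ => P)
      = ∑ q, ∑ q', ∫ p, g q p * g q' p ∂(Measure.pi fun _ => P) := by
        simp_rw [hsum, pow_two, Finset.sum_mul_sum]
        rw [integral_finsetSum _ fun q _ => integrable_finsetSum _ fun q' _ => hint q q']
        exact Finset.sum_congr rfl fun q _ => integral_finsetSum _ fun q' _ => hint q q'
    _ ≤ ∑ q, ∑ q', ((if q' = q then c q else 0) +
          (if q.1 = π q'.2 ∧ q'.1 = π q.2 then c q else 0)) :=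
        Finset.sum_le_sum fun q _ => Finset.sum_le_sum fun q' _ => hpair q q'
    _ ≤ ∑ q, 2 * c q := by
        refine Finset.sum_le_sum fun q _ => ?_
        rw [Finset.sum_add_distrib, Finset.sum_ite_eq' Finset.univ q, if_pos (Finset.mem_univ q)]
        linarith [hswap q]
    _ = 2 * (m * (4 * B ^ 2) + n * m * v) := by
        rw [← Finset.mul_sum]
        simp only [c, Finset.sum_add_distrib, hcount, Finset.sum_const, Finset.card_univ,
          Fintype.card_prod, Fintype.card_fin, nsmul_eq_mul, Nat.cast_mul]

end PairStatistic

/-! ### Duality for the chi-square divergence -/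

theorem integrable_of_abs_le {Ω : Type*} [MeasurableSpace Ω] (M : Measure Ω) [IsFiniteMeasure M]
    {u : Ω → ℝ} (hu : Measurable u) {B : ℝ} (hB : ∀ ω, |u ω| ≤ B) : Integrable u M :=
  Integrable.of_bound hu.aestronglyMeasurable B (ae_of_all _ hB)

theorem memLp_two_of_abs_le {Ω : Type*} [MeasurableSpace Ω] (M : Measure Ω) [IsFiniteMeasure M]
    {u : Ω → ℝ} (hu : Measurable u) {B : ℝ} (hB : ∀ ω, |u ω| ≤ B) : MemLp u 2 M :=
  MemLp.of_bound hu.aestronglyMeasurable B (ae_of_all _ hB)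

theorem sq_integral_le_integral_sq {Ω : Type*} [MeasurableSpace Ω] {M : Measure Ω}
    [IsProbabilityMeasure M] {f : Ω → ℝ} (hf : MemLp f 2 M) :
    (∫ ω, f ω ∂M) ^ 2 ≤ ∫ ω, f ω ^ 2 ∂M := by
  have h1 := ProbabilityTheory.variance_nonneg f M
  rw [ProbabilityTheory.variance_eq_sub hf] at h1
  simpa using h1

/-- The variational characterization of the chi-square divergence, in one direction: a bound on
the functional `f ↦ E_P[f]` in terms of the `L²(Q)`-norm makes the divergence finite. -/
theorem chiSqDiv_ne_top_of_forall_sq_le {Ω : Type*} [MeasurableSpace Ω] {P Q : Measure Ω}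
    [IsProbabilityMeasure P] [IsProbabilityMeasure Q] {C : ℝ}
    (h : ∀ f : Ω → ℝ, Measurable f → (∀ ω, 0 ≤ f ω) → (∃ B, ∀ ω, f ω ≤ B) →
      (∫ ω, f ω ∂P) ^ 2 ≤ C * ∫ ω, f ω ^ 2 ∂Q) : chiSqDiv P Q ≠ ∞ := by
  have hac : P ≪ Q := by
    refine Measure.AbsolutelyContinuous.mk fun s hs hQ => ?_
    have h1 := h (s.indicator 1) (measurable_one.indicator hs)
      (fun ω => Set.indicator_nonneg (fun _ _ => zero_le_one) ω)
      ⟨1, fun ω => Set.indicator_le_self' (fun _ _ => zero_le_one) ω⟩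
    have h2 : ∀ ω, (s.indicator (1 : Ω → ℝ) ω) ^ 2 = s.indicator 1 ω := fun ω => by
      by_cases hω : ω ∈ s <;> simp [hω]
    simp only [h2, integral_indicator_one hs, Measure.real, hQ, ENNReal.toReal_zero,
      mul_zero] at h1
    have h3 : (P s).toReal = 0 := by nlinarith [sq_nonneg (P s).toReal]
    exact ((ENNReal.toReal_eq_zero_iff _).1 h3).resolve_right (measure_ne_top P s)
  have hLm : Measurable fun ω => (P.rnDeriv Q ω).toReal :=
    (Measure.measurable_rnDeriv P Q).ennreal_toReal
  -- The truncated density is the nearly optimal test function: ∫ F² dQ ≤ ∫ F dP, so the hypothesis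
  -- gives (∫ F² dQ)² ≤ C ∫ F² dQ, and one factor cancels. Fatou's lemma then removes the
  -- truncation.
  let F : ℕ → Ω → ℝ := fun N ω => min (P.rnDeriv Q ω).toReal N
  have hFm : ∀ N, Measurable (F N) := fun N => hLm.min measurable_const
  have hF0 : ∀ N ω, 0 ≤ F N ω := fun N ω => le_min ENNReal.toReal_nonneg N.cast_nonneg
  have hFN : ∀ N ω, F N ω ≤ N := fun N ω => min_le_right _ _
  have hFi : ∀ N, Integrable (fun ω => F N ω ^ 2) Q := fun N =>
    Integrable.of_bound ((hFm N).pow_const 2).aestronglyMeasurable (N ^ 2 : ℝ)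
      (ae_of_all _ fun ω => by
        rw [Real.norm_eq_abs, abs_of_nonneg (sq_nonneg _)]
        exact pow_le_pow_left₀ (hF0 N ω) (hFN N ω) 2)
  have hbound : ∀ N, ∫ ω, F N ω ^ 2 ∂Q ≤ C := by
    intro N
    have h1 := h (F N) (hFm N) (hF0 N) ⟨N, hFN N⟩
    have h2 : ∫ ω, F N ω ^ 2 ∂Q ≤ ∫ ω, F N ω ∂P := by
      rw [← integral_rnDeriv_smul hac]
      refine integral_mono (hFi N) ?_ fun ω => ?_
      · exact (Measure.integrable_toReal_rnDeriv (μ := P) (ν := Q)).mul_bdd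
          (c := (N : ℝ)) (hFm N).aestronglyMeasurable
          (ae_of_all _ fun ω => by
            rw [Real.norm_eq_abs, abs_of_nonneg (hF0 N ω)]; exact hFN N ω)
      · simp only [smul_eq_mul, pow_two]
        exact mul_le_mul_of_nonneg_right (min_le_left _ _) (hF0 N ω)
    have h3 : 0 ≤ ∫ ω, F N ω ^ 2 ∂Q := integral_nonneg fun ω => sq_nonneg _
    have h4 : (∫ ω, F N ω ^ 2 ∂Q) ^ 2 ≤ C * ∫ ω, F N ω ^ 2 ∂Q :=
      (pow_le_pow_left₀ h3 h2 2).trans h1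
    rcases h3.eq_or_lt with h5 | h5
    -- No factor can be cancelled here; the constant function 1 shows C ≥ 1.
    · have h6 := h (fun _ => 1) measurable_const (fun _ => zero_le_one) ⟨1, fun _ => le_rfl⟩
      simp at h6
      linarith
    · nlinarith
  have hL2 : ∫⁻ ω, ENNReal.ofReal ((P.rnDeriv Q ω).toReal ^ 2) ∂Q ≤ ENNReal.ofReal C := by
    have hlim : ∀ ω, Tendsto (fun N => ENNReal.ofReal (F N ω ^ 2)) atTop
        (𝓝 (ENNReal.ofReal ((P.rnDeriv Q ω).toReal ^ 2))) := by
      intro ω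
      refine tendsto_const_nhds.congr' ?_
      obtain ⟨N₀, hN₀⟩ := exists_nat_ge (P.rnDeriv Q ω).toReal
      filter_upwards [eventually_ge_atTop N₀] with N hN
      have : F N ω = (P.rnDeriv Q ω).toReal :=
        min_eq_left (hN₀.trans (by exact_mod_cast hN))
      rw [this]
    calc _ = ∫⁻ ω, liminf (fun N => ENNReal.ofReal (F N ω ^ 2)) atTop ∂Q := by
          simp_rw [fun ω => (hlim ω).liminf_eq]
      _ ≤ liminf (fun N => ∫⁻ ω, ENNReal.ofReal (F N ω ^ 2) ∂Q) atTop :=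
          lintegral_liminf_le fun N => ((hFm N).pow_const 2).ennreal_ofReal
      _ ≤ liminf (fun _ : ℕ => ENNReal.ofReal C) atTop := by
          refine liminf_le_liminf (Eventually.of_forall fun N => ?_)
          rw [← ofReal_integral_eq_lintegral_ofReal (hFi N) (ae_of_all _ fun ω => sq_nonneg _)]
          exact ENNReal.ofReal_le_ofReal (hbound N)
      _ = ENNReal.ofReal C := by simp
  rw [chiSqDiv, if_pos hac]
  refine ne_top_of_le_ne_top (b := 2 * ENNReal.ofReal C + 2) (by finiteness) ?_
  calc _ ≤ ∫⁻ ω, (2 * ENNReal.ofReal ((P.rnDeriv Q ω).toReal ^ 2) + 2) ∂Q := by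
        refine lintegral_mono fun ω => ?_
        have e2 : (2 : ℝ≥0∞) = ENNReal.ofReal 2 := by simp
        simp only
        rw [e2, ← ENNReal.ofReal_mul (by norm_num), ← ENNReal.ofReal_add (by positivity)
          (by norm_num)]
        exact ENNReal.ofReal_le_ofReal (by nlinarith [sq_nonneg ((P.rnDeriv Q ω).toReal + 1)])
    _ ≤ _ := by
        rw [lintegral_add_right _ measurable_const,
          lintegral_const_mul _ (hLm.pow_const 2).ennreal_ofReal]
        simp only [lintegral_const, measure_univ, mul_one]
        gcongr

/-! ### Detection from infinite chi-square information -/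

section Centering

variable {𝒳 𝒴 : Type*} [MeasurableSpace 𝒳] [MeasurableSpace 𝒴]

/-- Double centering of a bounded function. -/
theorem exists_doubly_centered (P : Measure (𝒳 × 𝒴)) [IsProbabilityMeasure P] {f : 𝒳 × 𝒴 → ℝ}
    (hf : Measurable f) {B : ℝ} (hB : ∀ z, |f z| ≤ B) :
    ∃ g : 𝒳 × 𝒴 → ℝ, Measurable g ∧ (∀ z, |g z| ≤ 4 * B) ∧
      (∀ y, ∫ x, g (x, y) ∂P.fst = 0) ∧ (∀ x, ∫ y, g (x, y) ∂P.snd = 0) ∧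
      ∫ z, g z ∂P = ∫ z, f z ∂P - ∫ z, f z ∂(P.fst.prod P.snd) ∧
      ∫ z, g z ^ 2 ∂(P.fst.prod P.snd) ≤ 16 * ∫ z, f z ^ 2 ∂(P.fst.prod P.snd) := by
  set μ := P.fst
  set ν := P.snd
  set a : 𝒴 → ℝ := fun y => ∫ x, f (x, y) ∂μ with ha
  set b : 𝒳 → ℝ := fun x => ∫ y, f (x, y) ∂ν with hb
  set c : ℝ := ∫ z, f z ∂(μ.prod ν) with hc
  have ham : Measurable a := (hf.stronglyMeasurable.integral_prod_left').measurable
  have hbm : Measurable b := (hf.stronglyMeasurable.integral_prod_right').measurable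
  have hfx : ∀ y, Measurable fun x => f (x, y) := fun y =>
    hf.comp (measurable_id.prodMk measurable_const)
  have hfy : ∀ x, Measurable fun y => f (x, y) := fun x =>
    hf.comp (measurable_const.prodMk measurable_id)
  have haB : ∀ y, |a y| ≤ B := fun y => by
    simpa using norm_integral_le_of_norm_le_const (μ := μ) (f := fun x => f (x, y))
      (ae_of_all _ fun x => hB (x, y))
  have hbB : ∀ x, |b x| ≤ B := fun x => by
    simpa using norm_integral_le_of_norm_le_const (μ := ν) (f := fun y => f (x, y))
      (ae_of_all _ fun y => hB (x, y))
  have hcB : |c| ≤ B := by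
    simpa using norm_integral_le_of_norm_le_const (μ := μ.prod ν) (f := f) (ae_of_all _ hB)
  have hfi : Integrable f (μ.prod ν) := integrable_of_abs_le _ hf hB
  have hac : ∫ y, a y ∂ν = c := (integral_prod_symm f hfi).symm
  have hbc : ∫ x, b x ∂μ = c := (integral_prod f hfi).symm
  have ham2 : Measurable fun z : 𝒳 × 𝒴 => a z.2 := ham.comp measurable_snd
  have hbm2 : Measurable fun z : 𝒳 × 𝒴 => b z.1 := hbm.comp measurable_fst
  refine ⟨fun z => f z - a z.2 - b z.1 + c, by fun_prop, fun z => ?_, fun y => ?_, fun x => ?_,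
    ?_, ?_⟩
  · have h1 := abs_le.1 (hB z)
    have h2 := abs_le.1 (haB z.2)
    have h3 := abs_le.1 (hbB z.1)
    have h4 := abs_le.1 hcB
    exact abs_le.2 ⟨by linarith, by linarith⟩
  · have i1 := integrable_of_abs_le μ (hfx y) fun x => hB (x, y)
    have i2 := integrable_of_abs_le μ hbm hbB
    have i3 : Integrable (fun x => f (x, y) - a y) μ := i1.sub (integrable_const _)
    have i4 : Integrable (fun x => f (x, y) - a y - b x) μ := i3.sub i2
    simp only
    rw [integral_add i4 (integrable_const _), integral_sub i3 i2,
      integral_sub i1 (integrable_const _), hbc]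
    simp [ha]
  · have i1 := integrable_of_abs_le ν (hfy x) fun y => hB (x, y)
    have i2 := integrable_of_abs_le ν ham haB
    have i3 : Integrable (fun y => f (x, y) - a y) ν := i1.sub i2
    have i4 : Integrable (fun y => f (x, y) - a y - b x) ν := i3.sub (integrable_const _)
    simp only
    rw [integral_add i4 (integrable_const _), integral_sub i3 (integrable_const _),
      integral_sub i1 i2, hac]
    simp [hb]
  · have i1 := integrable_of_abs_le P hf hB
    have i2 := integrable_of_abs_le P ham2 fun z => haB z.2
    have i3 := integrable_of_abs_le P hbm2 fun z => hbB z.1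
    have i12 : Integrable (fun z => f z - a z.2) P := i1.sub i2
    have i123 : Integrable (fun z => f z - a z.2 - b z.1) P := i12.sub i3
    rw [integral_add i123 (integrable_const _), integral_sub i12 i3, integral_sub i1 i2]
    have e1 : ∫ z, a z.2 ∂P = c := by
      rw [← hac, show ν = P.map Prod.snd from rfl,
        integral_map measurable_snd.aemeasurable ham.aestronglyMeasurable]
    have e2 : ∫ z, b z.1 ∂P = c := by
      rw [← hbc, show μ = P.map Prod.fst from rfl,
        integral_map measurable_fst.aemeasurable hbm.aestronglyMeasurable]
    rw [e1, e2]
    simp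
  · have hv : Integrable (fun z => f z ^ 2) (μ.prod ν) := (memLp_two_of_abs_le _ hf hB).integrable_sq
    have ia : Integrable (fun z : 𝒳 × 𝒴 => a z.2 ^ 2) (μ.prod ν) :=
      (memLp_two_of_abs_le _ ham2 fun z => haB z.2).integrable_sq
    have ib : Integrable (fun z : 𝒳 × 𝒴 => b z.1 ^ 2) (μ.prod ν) :=
      (memLp_two_of_abs_le _ hbm2 fun z => hbB z.1).integrable_sq
    have la : ∫ z : 𝒳 × 𝒴, a z.2 ^ 2 ∂(μ.prod ν) ≤ ∫ z, f z ^ 2 ∂(μ.prod ν) := by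
      rw [integral_prod_symm _ ia, integral_prod_symm _ hv]
      refine integral_mono_of_nonneg (ae_of_all _ fun y => integral_nonneg fun x => sq_nonneg _)
        hv.integral_prod_right (ae_of_all _ fun y => ?_)
      simpa using sq_integral_le_integral_sq (memLp_two_of_abs_le μ (hfx y) fun x => hB (x, y))
    have lb : ∫ z : 𝒳 × 𝒴, b z.1 ^ 2 ∂(μ.prod ν) ≤ ∫ z, f z ^ 2 ∂(μ.prod ν) := by
      rw [integral_prod _ ib, integral_prod _ hv]
      refine integral_mono_of_nonneg (ae_of_all _ fun x => integral_nonneg fun y => sq_nonneg _)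
        hv.integral_prod_left (ae_of_all _ fun x => ?_)
      simpa using sq_integral_le_integral_sq (memLp_two_of_abs_le ν (hfy x) fun y => hB (x, y))
    have lc : c ^ 2 ≤ ∫ z, f z ^ 2 ∂(μ.prod ν) := sq_integral_le_integral_sq (memLp_two_of_abs_le _ hf hB)
    have i12 : Integrable (fun z => 4 * f z ^ 2 + 4 * a z.2 ^ 2) (μ.prod ν) :=
      (hv.const_mul 4).add (ia.const_mul 4)
    have i123 : Integrable (fun z => 4 * f z ^ 2 + 4 * a z.2 ^ 2 + 4 * b z.1 ^ 2) (μ.prod ν) :=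
      i12.add (ib.const_mul 4)
    -- The square of a sum of four terms is at most four times the sum of squares, and by Jensen
    -- each conditional mean has second moment at most that of f; hence 16.
    have hle : ∫ z, (f z - a z.2 - b z.1 + c) ^ 2 ∂(μ.prod ν) ≤
        ∫ z, (4 * f z ^ 2 + 4 * a z.2 ^ 2 + 4 * b z.1 ^ 2 + 4 * c ^ 2) ∂(μ.prod ν) := by
      refine integral_mono_of_nonneg (ae_of_all _ fun z => sq_nonneg _)
        (i123.add (integrable_const _)) (ae_of_all _ fun z => ?_)
      simp only
      nlinarith [sq_nonneg (f z + a z.2), sq_nonneg (f z + b z.1), sq_nonneg (f z - c),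
        sq_nonneg (a z.2 - b z.1), sq_nonneg (a z.2 + c), sq_nonneg (b z.1 + c)]
    rw [integral_add i123 (integrable_const _), integral_add i12 (ib.const_mul 4),
      integral_add (hv.const_mul 4) (ia.const_mul 4)] at hle
    simp only [integral_const_mul, integral_const, probReal_univ, one_smul] at hle
    linarith

/-- If the chi-square information is infinite, there are bounded doubly centered functions with an
arbitrarily large signal-to-noise ratio. -/
theorem exists_signal_of_chiSqInfo_eq_top (P : Measure (𝒳 × 𝒴)) [IsProbabilityMeasure P]
    (hP : chiSqInfo P = ∞) {C : ℝ} (hC : 0 < C) :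
    ∃ (g : 𝒳 × 𝒴 → ℝ) (B : ℝ), Measurable g ∧ (∀ z, |g z| ≤ B) ∧
      (∀ y, ∫ x, g (x, y) ∂P.fst = 0) ∧ (∀ x, ∫ y, g (x, y) ∂P.snd = 0) ∧
      0 < ∫ z, g z ∂P ∧
      C * ∫ z, g z ^ 2 ∂(P.fst.prod P.snd) ≤ (∫ z, g z ∂P) ^ 2 := by
  by_contra hcon
  -- The 4 is √16, the loss in the L² norm under double centering. The 1 pays for the mean of f
  -- under the product law, which is at most √v and is subtracted by the centering.
  refine chiSqDiv_ne_top_of_forall_sq_le (P := P) (Q := P.fst.prod P.snd)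
    (C := (4 * Real.sqrt C + 1) ^ 2) ?_ hP
  rintro f hf h0 ⟨B, hB⟩
  by_contra! hlt
  have hfB : ∀ z, |f z| ≤ B := fun z => by rw [abs_of_nonneg (h0 z)]; exact hB z
  obtain ⟨g, hg, hgB, hgX, hgY, hge, hgv⟩ := exists_doubly_centered P hf hfB
  set v := ∫ z, f z ^ 2 ∂(P.fst.prod P.snd)
  have hv : 0 ≤ v := integral_nonneg fun z => sq_nonneg _
  have hc : ∫ z, f z ∂(P.fst.prod P.snd) ≤ Real.sqrt v := by
    refine Real.le_sqrt_of_sq_le (sq_integral_le_integral_sq ?_)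
    exact MemLp.of_bound hf.aestronglyMeasurable B (ae_of_all _ hfB)
  have hE : (4 * Real.sqrt C + 1) * Real.sqrt v < ∫ z, f z ∂P := by
    refine lt_of_pow_lt_pow_left₀ 2 (integral_nonneg h0) ?_
    rwa [mul_pow, Real.sq_sqrt hv]
  have hpos : 4 * Real.sqrt C * Real.sqrt v < ∫ z, g z ∂P := by
    rw [hge]; linarith
  refine hcon ⟨g, 4 * B, hg, hgB, hgX, hgY, lt_of_le_of_lt (by positivity) hpos, ?_⟩
  calc C * ∫ z, g z ^ 2 ∂(P.fst.prod P.snd) ≤ C * (16 * v) := by gcongr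
    _ = (4 * Real.sqrt C * Real.sqrt v) ^ 2 := by
        rw [mul_pow, mul_pow, Real.sq_sqrt hv, Real.sq_sqrt hC.le]; ring
    _ ≤ _ := pow_le_pow_left₀ (by positivity) hpos.le 2

/-- The test that thresholds the pair statistic halfway has small error probabilities. -/
theorem exists_test_of_signal (P : Measure (𝒳 × 𝒴)) [IsProbabilityMeasure P] {g : 𝒳 × 𝒴 → ℝ}
    {B : ℝ} (hg : Measurable g) (hB : ∀ z, |g z| ≤ B)
    (hX : ∀ y, ∫ x, g (x, y) ∂P.fst = 0) (hY : ∀ x, ∫ y, g (x, y) ∂P.snd = 0)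
    (he : 0 < ∫ z, g z ∂P) {n m : ℕ} (hm : 0 < m) (hmn : m ≤ n) :
    ∃ A : Set ((Fin n → 𝒳) × (Fin m → 𝒴)), MeasurableSet A ∧
      nullLaw P n m A ≤ ENNReal.ofReal
        (2 * (m * (4 * B ^ 2) + n * m * ∫ z, g z ^ 2 ∂(P.fst.prod P.snd)) /
          (m * (∫ z, g z ∂P) / 2) ^ 2) ∧
      altLaw P n m Aᶜ ≤ ENNReal.ofReal
        (2 * (m * (4 * B ^ 2) + n * m * ∫ z, g z ^ 2 ∂(P.fst.prod P.snd)) /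
          (m * (∫ z, g z ∂P) / 2) ^ 2) := by
  set e := ∫ z, g z ∂P
  have ha : (0 : ℝ) < m * e / 2 := by positivity
  have hAm : MeasurableSet {d : (Fin n → 𝒳) × (Fin m → 𝒴) | m * e / 2 ≤ pairSum g d} :=
    measurableSet_le measurable_const (measurable_pairSum hg)
  have hbdd (c : ℝ) (π : Fin m ↪ Fin n) (M : Measure (Fin n → 𝒳 × 𝒴)) [IsProbabilityMeasure M] :
      Integrable (fun p => (pairSum g (observe π p) - c) ^ 2) M := by
    refine Integrable.of_bound ((((measurable_pairSum hg).comp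
      (measurable_observe π)).sub_const c).pow_const 2).aestronglyMeasurable
      (((Fintype.card (Fin n × Fin m) : ℝ) * B + |c|) ^ 2) (ae_of_all _ fun p => ?_)
    rw [norm_pow]
    refine pow_le_pow_left₀ (norm_nonneg _) ((norm_sub_le _ _).trans
      (add_le_add ((norm_sum_le _ _).trans ?_) le_rfl)) 2
    calc _ ≤ ∑ _q : Fin n × Fin m, B := Finset.sum_le_sum fun q _ => hB _
      _ = _ := by simp
  refine ⟨_, hAm, ?_, altLaw_apply_le P hmn _ fun π => ?_⟩
  · have π : Fin m ↪ Fin n := Fin.castLEEmb hmn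
    rw [nullLaw_eq_map_observe P π, Measure.map_apply (measurable_observe π) hAm]
    -- The same variance bound with the product law as the law of the pairs; its marginals are
    -- unchanged and the mean of g vanishes.
    have h1 := integral_pairSum_sub_sq_le (P.fst.prod P.snd) hg hB (by simpa using hX)
      (by simpa using hY) π
    have h0 : ∫ z, g z ∂(P.fst.prod P.snd) = 0 := by
      rw [integral_prod _ (Integrable.of_bound hg.aestronglyMeasurable B (ae_of_all _ hB))]
      simp [hY]
    rw [Measure.fst_prod, Measure.snd_prod, h0, mul_zero] at h1
    refine (measure_mono fun p hp => ?_).trans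
      (measure_le_abs_le_ofReal _ (hbdd 0 π _) ha h1)
    simp only [Set.mem_preimage, Set.mem_ofPred_eq, sub_zero] at hp ⊢
    exact hp.trans (le_abs_self _)
  · rw [altLawGiven_eq_map_observe, Measure.map_apply (measurable_observe π) hAm.compl]
    refine (measure_mono fun p hp => ?_).trans
      (measure_le_abs_le_ofReal _ (hbdd (m * e) π _) ha
        (integral_pairSum_sub_sq_le P hg hB hX hY π))
    simp only [Set.mem_preimage, Set.mem_compl_iff, Set.mem_ofPred_eq, not_le] at hp ⊢
    rw [le_abs]
    right
    linarith

/-- Strong detection is possible if the chi-square information is infinite. -/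
theorem strongDetection_of_chiSqInfo_eq_top (P : Measure (𝒳 × 𝒴)) [IsProbabilityMeasure P]
    (hP : chiSqInfo P = ∞) {α : ℝ} (hα : 0 < α) {n m : ℕ → ℕ} (hn : Tendsto n atTop atTop)
    (hmn : ∀ k, m k ≤ n k) (hm : ∀ k, |(m k : ℝ) - α * (n k : ℝ)| < 1) :
    StrongDetection P n m := by
  refine strongDetection_of_forall_eventually P n m fun ε hε => ?_
  obtain ⟨δ, hδ, hδε⟩ : ∃ δ : ℝ, 0 < δ ∧ ENNReal.ofReal δ ≤ ε := by
    rcases eq_or_ne ε ∞ with rfl | h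
    · exact ⟨1, one_pos, le_top⟩
    · exact ⟨ε.toReal, ENNReal.toReal_pos hε.ne' h, (ENNReal.ofReal_toReal h).le⟩
  -- The error bound equals 8(4B² + nv)/(me²). With m ≥ αn/2, the v-part is at most 16v/(αe²) ≤ δ/2
  -- by this choice of C, and the B-part is at most 64B²/(αne²) ≤ δ/2 once n ≥ 128B²/(αδe²).
  obtain ⟨g, B, hg, hB, hX, hY, he, hsig⟩ :=
    exists_signal_of_chiSqInfo_eq_top P hP (C := 32 / (α * δ)) (by positivity)
  set e := ∫ z, g z ∂P
  set v := ∫ z, g z ^ 2 ∂(P.fst.prod P.snd)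
  have hv : 0 ≤ v := integral_nonneg fun z => sq_nonneg _
  have hnR : Tendsto (fun k => (n k : ℝ)) atTop atTop := tendsto_natCast_atTop_atTop.comp hn
  filter_upwards [hnR.eventually_ge_atTop (2 / α),
    hnR.eventually_ge_atTop (128 * B ^ 2 / (α * δ * e ^ 2))] with k hk1 hk2
  rw [div_le_iff₀ (by positivity)] at hk1 hk2
  have hmk : α * n k / 2 ≤ m k := by
    have := (abs_lt.1 (hm k)).1
    linarith
  have hmpos : 0 < (m k : ℝ) := by nlinarith
  obtain ⟨A, hA, h1, h2⟩ := exists_test_of_signal P hg hB hX hY he (by exact_mod_cast hmpos)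
    (hmn k)
  have hfin : 2 * (m k * (4 * B ^ 2) + n k * m k * v) / (m k * e / 2) ^ 2 ≤ δ := by
    rw [div_le_iff₀ (by positivity)]
    have h3 : 32 * v ≤ α * δ * e ^ 2 := by
      rw [div_mul_eq_mul_div, div_le_iff₀ (by positivity)] at hsig
      linarith
    have h4 : 32 * (4 * B ^ 2 + n k * v) ≤ 2 * (n k * (α * δ * e ^ 2)) := by
      have := mul_le_mul_of_nonneg_left h3 (n k).cast_nonneg (α := ℝ)
      nlinarith
    have h5 : n k * (α * δ * e ^ 2) ≤ 2 * (m k * (δ * e ^ 2)) := by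
      have : 0 ≤ δ * e ^ 2 := by positivity
      nlinarith
    have h6 : 8 * (4 * B ^ 2 + n k * v) ≤ m k * (δ * e ^ 2) := by linarith
    nlinarith
  exact ⟨A, hA, h1.trans ((ENNReal.ofReal_le_ofReal hfin).trans hδε),
    h2.trans ((ENNReal.ofReal_le_ofReal hfin).trans hδε)⟩

end Centering

/-! ### Sums of i.i.d. variables: small balls and second moments -/

/-- The density is at most 1/√(2π) ≤ 1/2, so the mass is at most a. The slack up to 2a turns a bound
on a limsup into an eventual bound. -/
theorem gaussianReal_Icc_lt {a : ℝ} (ha : 0 < a) :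
    ProbabilityTheory.gaussianReal 0 1 (Set.Icc (-a) a) < ENNReal.ofReal (2 * a) := by
  have hpdf : ∀ x, ProbabilityTheory.gaussianPDF 0 1 x ≤ ENNReal.ofReal (1 / 2) := by
    intro x
    refine ENNReal.ofReal_le_ofReal ?_
    rw [ProbabilityTheory.gaussianPDFReal_def]
    have h1 : Real.exp (-(x - 0) ^ 2 / (2 * ((1 : NNReal) : ℝ))) ≤ 1 := by
      rw [Real.exp_le_one_iff]
      have := sq_nonneg (x - 0)
      simp only [NNReal.coe_one]
      linarith
    have h2 : 2 ≤ Real.sqrt (2 * Real.pi * ((1 : NNReal) : ℝ)) := by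
      refine Real.le_sqrt_of_sq_le ?_
      simp only [NNReal.coe_one]
      nlinarith [Real.two_le_pi]
    have h3 : (Real.sqrt (2 * Real.pi * ((1 : NNReal) : ℝ)))⁻¹ ≤ 1 / 2 := by
      rw [one_div]
      exact inv_anti₀ two_pos h2
    calc _ ≤ (1 / 2 : ℝ) * 1 := mul_le_mul h3 h1 (Real.exp_pos _).le (by norm_num)
      _ = 1 / 2 := mul_one _
  calc ProbabilityTheory.gaussianReal 0 1 (Set.Icc (-a) a)
      = ∫⁻ x in Set.Icc (-a) a, ProbabilityTheory.gaussianPDF 0 1 x :=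
        ProbabilityTheory.gaussianReal_apply 0 one_ne_zero _
    _ ≤ ∫⁻ _x in Set.Icc (-a) a, ENNReal.ofReal (1 / 2) := lintegral_mono fun x => hpdf x
    _ = ENNReal.ofReal (1 / 2 * (2 * a)) := by
        rw [lintegral_const, Measure.restrict_apply_univ, Real.volume_Icc,
          ← ENNReal.ofReal_mul (by norm_num)]
        congr 1
        ring
    _ < ENNReal.ofReal (2 * a) :=
        (ENNReal.ofReal_lt_ofReal_iff (by positivity)).2 (by linarith)

/-- A small-ball estimate for sums of i.i.d. variables, from the central limit theorem. -/
theorem eventually_measure_abs_sum_le {Ω : Type*} [MeasurableSpace Ω] (Q : Measure Ω)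
    [IsProbabilityMeasure Q] {G : Ω → ℝ} (hG : Measurable G) (h0 : ∫ ω, G ω ∂Q = 0)
    (h1 : ∫ ω, G ω ^ 2 ∂Q = 1) {a : ℝ} (ha : 0 < a) :
    ∀ᶠ n : ℕ in atTop, (Measure.pi fun _ : Fin n => Q)
      {p | |∑ j, G (p j)| ≤ a * Real.sqrt n} ≤ ENNReal.ofReal (2 * a) := by
  -- The central limit theorem is applied to one infinite i.i.d. sequence, whose first n entries
  -- have the required product law (`hpi`); the portmanteau theorem for the closed interval [-a, a]
  -- then gives the bound.
  obtain ⟨Ω', mΩ', M, X, hXm, hXlaw, hXind, hM⟩ := ProbabilityTheory.exists_iid ℕ Q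
  have hYm : ∀ i, Measurable (G ∘ X i) := fun i => hG.comp (hXm i)
  have hint (i : ℕ) (u : Ω → ℝ) (hu : Measurable u) : ∫ ω, u (X i ω) ∂M = ∫ z, u z ∂Q := by
    rw [← (hXlaw i).map_eq, integral_map (hXm i).aemeasurable hu.aestronglyMeasurable]
  have hclt := ProbabilityTheory.tendstoInDistribution_inv_sqrt_mul_sum
    (P := M) (P' := ProbabilityTheory.gaussianReal 0 1) (Y := id) (X := fun i => G ∘ X i)
    ⟨aemeasurable_id, Measure.map_id⟩
    (by simpa [h0] using hint 0 G hG)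
    ((hint 0 (fun z => G z ^ 2) (hG.pow_const 2)).trans h1)
    (hXind.comp (fun _ => G) fun _ => hG)
    (fun i => ⟨(hYm i).aemeasurable, (hYm 0).aemeasurable, by
      rw [← Measure.map_map hG (hXm i), ← Measure.map_map hG (hXm 0), (hXlaw i).map_eq,
        (hXlaw 0).map_eq]⟩)
  have hlim := ProbabilityMeasure.limsup_measure_closed_le_of_tendsto hclt.tendsto
    (isClosed_Icc (a := -a) (b := a))
  have hlt := eventually_lt_of_limsup_lt (lt_of_le_of_lt hlim
    (c := ENNReal.ofReal (2 * a)) (by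
      simp only [ProbabilityMeasure.coe_mk, Measure.map_id]
      exact gaussianReal_Icc_lt ha))
  filter_upwards [hlt, eventually_gt_atTop 0] with n hn hn0
  refine le_trans (le_of_eq ?_) hn.le
  have hpi : M.map (fun ω (i : Fin n) => X i ω) = Measure.pi fun _ => Q := by
    have := (ProbabilityTheory.iIndepFun_iff_map_fun_eq_pi_map
      (f := fun (i : Fin n) => X i) fun i => (hXm i).aemeasurable).1
      (hXind.precomp Fin.val_injective)
    rw [this]
    congr 1
    funext i
    exact (hXlaw i).map_eq
  have hsq : 0 < Real.sqrt n := Real.sqrt_pos.2 (by exact_mod_cast hn0)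
  have hmS : Measurable fun ω => (Real.sqrt n)⁻¹ * ∑ k ∈ Finset.range n, (G ∘ X k) ω :=
    (Finset.measurable_fun_sum _ fun k _ => hYm k).const_mul _
  rw [← hpi, Measure.map_apply (by fun_prop)
    (measurableSet_le (by fun_prop) measurable_const)]
  refine Eq.trans ?_ (Measure.map_apply hmS measurableSet_Icc).symm
  congr 1
  ext ω
  simp only [Set.mem_preimage, Set.mem_ofPred_eq, Set.mem_Icc, Function.comp_apply]
  rw [← abs_le, Fin.sum_univ_eq_sum_range (fun k => G (X k ω)) n, abs_mul,
    abs_of_pos (inv_pos.2 hsq), inv_mul_le_iff₀ hsq, mul_comm a]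

/-- The second moment of a sum of i.i.d. centered variables. -/
theorem integral_sum_sq_pi {Ω : Type*} [MeasurableSpace Ω] (M : Measure Ω)
    [IsProbabilityMeasure M] {u : Ω → ℝ} (hu : MemLp u 2 M) (h0 : ∫ ω, u ω ∂M = 0) (n : ℕ) :
    MemLp (fun p : Fin n → Ω => ∑ j, u (p j)) 2 (Measure.pi fun _ => M) ∧
    ∫ p : Fin n → Ω, (∑ j, u (p j)) ^ 2 ∂(Measure.pi fun _ => M) = n * ∫ ω, u ω ^ 2 ∂M := by
  have hj : ∀ j : Fin n, MemLp (fun p : Fin n → Ω => u (p j)) 2 (Measure.pi fun _ => M) :=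
    fun j => hu.comp_measurePreserving (measurePreserving_eval _ j)
  have hS : MemLp (fun p : Fin n → Ω => ∑ j, u (p j)) 2 (Measure.pi fun _ => M) :=
    memLp_finsetSum _ fun j _ => hj j
  refine ⟨hS, ?_⟩
  have hmean : ∫ p : Fin n → Ω, ∑ j, u (p j) ∂(Measure.pi fun _ => M) = 0 := by
    rw [integral_finsetSum _ fun j _ => (hj j).integrable (by norm_num)]
    refine Finset.sum_eq_zero fun j _ => ?_
    have h := (measurePreserving_eval (fun _ : Fin n => M) j)
    have h2 := integral_map (φ := Function.eval j) (f := u) h.measurable.aemeasurable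
      (by rw [h.map_eq]; exact hu.aestronglyMeasurable)
    rw [h.map_eq, h0] at h2
    exact h2.symm
  have hvar := ProbabilityTheory.variance_sum_pi (μ := fun _ : Fin n => M) (X := fun _ => u)
    fun _ => hu
  have hfun : (∑ i : Fin n, fun ω : Fin n → Ω => u (ω i)) = fun p => ∑ j, u (p j) := by
    funext p; simp
  rw [hfun, ProbabilityTheory.variance_eq_sub hS, ProbabilityTheory.variance_eq_sub hu,
    hmean, h0] at hvar
  simpa using hvar

/-! ### Detection from maximal correlation one at equal sample sizes -/

section MaximalCorrelation

variable {𝒳 𝒴 : Type*} [MeasurableSpace 𝒳] [MeasurableSpace 𝒴]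

/-- The second moment of the difference of two centered, normalized functions. -/
theorem integral_sub_sq_of_normalized (P' : Measure (𝒳 × 𝒴)) [IsProbabilityMeasure P']
    {g : 𝒳 → ℝ} {h : 𝒴 → ℝ} (hg : Measurable g) (hh : Measurable h) (hg2 : MemLp g 2 P'.fst)
    (hh2 : MemLp h 2 P'.snd) (hg0 : ∫ x, g x ∂P'.fst = 0) (hh0 : ∫ y, h y ∂P'.snd = 0)
    (hg1 : ∫ x, g x ^ 2 ∂P'.fst = 1) (hh1 : ∫ y, h y ^ 2 ∂P'.snd = 1) :
    MemLp (fun p : 𝒳 × 𝒴 => g p.1 - h p.2) 2 P' ∧ ∫ p, (g p.1 - h p.2) ∂P' = 0 ∧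
      ∫ p, (g p.1 - h p.2) ^ 2 ∂P' = 2 - 2 * ∫ p, g p.1 * h p.2 ∂P' := by
  have mp1 : MeasurePreserving Prod.fst P' P'.fst := ⟨measurable_fst, rfl⟩
  have mp2 : MeasurePreserving Prod.snd P' P'.snd := ⟨measurable_snd, rfl⟩
  have m1 : MemLp (fun p : 𝒳 × 𝒴 => g p.1) 2 P' := hg2.comp_measurePreserving mp1
  have m2 : MemLp (fun p : 𝒳 × 𝒴 => h p.2) 2 P' := hh2.comp_measurePreserving mp2
  have e1 {u : 𝒳 → ℝ} (hu : Measurable u) : ∫ p, u p.1 ∂P' = ∫ x, u x ∂P'.fst :=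
    (integral_map measurable_fst.aemeasurable hu.aestronglyMeasurable).symm
  have e2 {u : 𝒴 → ℝ} (hu : Measurable u) : ∫ p, u p.2 ∂P' = ∫ x, u x ∂P'.snd :=
    (integral_map measurable_snd.aemeasurable hu.aestronglyMeasurable).symm
  refine ⟨m1.sub m2, ?_, ?_⟩
  · rw [integral_sub (m1.integrable (by norm_num)) (m2.integrable (by norm_num)), e1 hg, e2 hh,
      hg0, hh0, sub_zero]
  · have i1 := m1.integrable_sq
    have i2 := m2.integrable_sq
    have i3 : Integrable (fun p : 𝒳 × 𝒴 => g p.1 * h p.2) P' := m1.integrable_mul m2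
    have i12 : Integrable (fun p : 𝒳 × 𝒴 => g p.1 ^ 2 + h p.2 ^ 2) P' := i1.add i2
    have : ∀ p : 𝒳 × 𝒴, (g p.1 - h p.2) ^ 2 =
        (g p.1 ^ 2 + h p.2 ^ 2) - 2 * (g p.1 * h p.2) := fun p => by ring
    simp_rw [this]
    rw [integral_sub i12 (i3.const_mul 2), integral_add i1 i2, integral_const_mul,
      e1 (hg.pow_const 2), e2 (hh.pow_const 2), hg1, hh1]
    ring

/-- Strong detection is possible at equal sample sizes if the maximal correlation is one. -/
theorem strongDetection_of_maximalCorrelation_eq_one (P : Measure (𝒳 × 𝒴))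
    [IsProbabilityMeasure P] (hP : maximalCorrelation P = 1) {n : ℕ → ℕ}
    (hn : Tendsto n atTop atTop) : StrongDetection P n n := by
  refine strongDetection_of_forall_eventually P n n fun ε hε => ?_
  obtain ⟨δ, hδ, hδε⟩ : ∃ δ : ℝ, 0 < δ ∧ ENNReal.ofReal δ ≤ ε := by
    rcases eq_or_ne ε ∞ with rfl | h
    · exact ⟨1, one_pos, le_top⟩
    · exact ⟨ε.toReal, ENNReal.toReal_pos hε.ne' h, (ENNReal.ofReal_toReal h).le⟩
  set a := δ / 2 with ha_def
  have ha : 0 < a := by positivity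
  -- The threshold will be t = a√(2n). Under the alternative the variance is n(2 - 2c) < 2nδa² =
  -- δt², so Chebyshev gives error δ; under the null the small-ball bound gives 2a = δ.
  obtain ⟨c, ⟨g, h, hg, hh, hg2, hh2, hg0, hh0, hg1, hh1, hc⟩, hlt⟩ :
      ∃ c ∈ {c : ℝ | ∃ (g : 𝒳 → ℝ) (h : 𝒴 → ℝ),
        Measurable g ∧ Measurable h ∧ MemLp g 2 P.fst ∧ MemLp h 2 P.snd ∧
        ∫ x, g x ∂P.fst = 0 ∧ ∫ y, h y ∂P.snd = 0 ∧
        ∫ x, g x ^ 2 ∂P.fst = 1 ∧ ∫ y, h y ^ 2 ∂P.snd = 1 ∧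
        c = ∫ p, g p.1 * h p.2 ∂P}, 1 - δ * a ^ 2 < c := by
    refine exists_lt_of_lt_csSup ?_ ?_
    -- An empty supremum would be 0, not 1.
    · rw [Set.nonempty_iff_ne_empty]
      intro hemp
      rw [maximalCorrelation, hemp, Real.sSup_empty] at hP
      norm_num at hP
    · change _ < maximalCorrelation P
      rw [hP]
      have : 0 < δ * a ^ 2 := by positivity
      linarith
  obtain ⟨hPm, hP0, hP2⟩ := integral_sub_sq_of_normalized P hg hh hg2 hh2 hg0 hh0 hg1 hh1
  obtain ⟨-, hQ0, hQ2⟩ := integral_sub_sq_of_normalized (P.fst.prod P.snd) hg hh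
    (by simpa using hg2) (by simpa using hh2) (by simpa using hg0) (by simpa using hh0)
    (by simpa using hg1) (by simpa using hh1)
  rw [integral_prod_mul, hg0, zero_mul, mul_zero, sub_zero] at hQ2
  have s2 : 0 < Real.sqrt 2 := by positivity
  have hGm : Measurable fun p : 𝒳 × 𝒴 => (g p.1 - h p.2) / Real.sqrt 2 := by fun_prop
  have hball := eventually_measure_abs_sum_le (P.fst.prod P.snd) hGm
    (by rw [integral_div, hQ0, zero_div])
    (by simp_rw [div_pow]; rw [integral_div, hQ2, Real.sq_sqrt two_pos.le]; norm_num) ha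
  filter_upwards [hn.eventually hball, hn.eventually_gt_atTop 0] with k hk hk0
  have hk0' : (0 : ℝ) < n k := by exact_mod_cast hk0
  -- At equal sizes the latent injection is a bijection, so S is the sum of g - h over the hidden
  -- pairs, whatever the matching.
  let S : (Fin (n k) → 𝒳) × (Fin (n k) → 𝒴) → ℝ := fun d => ∑ j, g (d.1 j) - ∑ i, h (d.2 i)
  have hSm : Measurable S := by fun_prop
  have hSobs (π : Fin (n k) ↪ Fin (n k)) (p : Fin (n k) → 𝒳 × 𝒴) :
      S (observe π p) = ∑ j, (g (p j).1 - h (p j).2) := by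
    have hb : Function.Bijective π := Finite.injective_iff_bijective.1 π.injective
    simp only [S, observe, Finset.sum_sub_distrib]
    rw [hb.sum_comp fun j => h (p j).2]
  set t := a * (Real.sqrt 2 * Real.sqrt (n k)) with ht_def
  have ht : 0 < t := by positivity
  have hA : MeasurableSet {d | |S d| ≤ t} := measurableSet_le hSm.abs measurable_const
  refine ⟨_, hA, ?_, altLaw_apply_le P le_rfl _ fun π => ?_⟩
  · rw [nullLaw_eq_map_observe P (Function.Embedding.refl _),
      Measure.map_apply (measurable_observe _) hA]
    refine le_trans (le_trans (measure_mono fun p hp => ?_) hk) ?_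
    · simp only [Set.mem_preimage, Set.mem_ofPred_eq, hSobs] at hp ⊢
      rw [← Finset.sum_div, abs_div, abs_of_pos s2, div_le_iff₀ s2]
      linarith
    · rw [ha_def, mul_div_cancel₀ _ two_ne_zero]
      exact hδε
  · rw [altLawGiven_eq_map_observe, Measure.map_apply (measurable_observe _) hA.compl]
    obtain ⟨hm, hv⟩ := integral_sum_sq_pi P hPm hP0 (n k)
    refine ((measure_mono fun p hp => ?_).trans
      (measure_le_abs_le_ofReal _ hm.integrable_sq ht hv.le)).trans
      ((ENNReal.ofReal_le_ofReal ?_).trans hδε)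
    · simp only [Set.mem_preimage, Set.mem_compl_iff, Set.mem_ofPred_eq, not_le, hSobs] at hp ⊢
      exact hp.le
    · rw [div_le_iff₀ (by positivity), hP2, ← hc, ht_def, mul_pow, mul_pow,
        Real.sq_sqrt two_pos.le, Real.sq_sqrt hk0'.le]
      nlinarith

end MaximalCorrelation

/-! ### The centered kernel and its operator norm -/

section Kernel

variable {𝒳 𝒴 : Type*} [MeasurableSpace 𝒳] [MeasurableSpace 𝒴]

theorem sq_integral_mul_le {Ω : Type*} [MeasurableSpace Ω] {M : Measure Ω} {f g : Ω → ℝ}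
    (hf : MemLp f 2 M) (hg : MemLp g 2 M) :
    (∫ ω, f ω * g ω ∂M) ^ 2 ≤ (∫ ω, f ω ^ 2 ∂M) * ∫ ω, g ω ^ 2 ∂M := by
  have i1 := hf.integrable_sq
  have i2 := hg.integrable_sq
  have i3 : Integrable (fun ω => f ω * g ω) M := hf.integrable_mul hg
  have key : ∀ t : ℝ, 0 ≤ (∫ ω, g ω ^ 2 ∂M) * (t * t) + (-2 * ∫ ω, f ω * g ω ∂M) * t +
      ∫ ω, f ω ^ 2 ∂M := by
    intro t
    have h0 : 0 ≤ ∫ ω, (f ω - t * g ω) ^ 2 ∂M := integral_nonneg fun ω => sq_nonneg _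
    have e : ∀ ω, (f ω - t * g ω) ^ 2 = (f ω ^ 2 - (2 * t) * (f ω * g ω)) + t ^ 2 * g ω ^ 2 :=
      fun ω => by ring
    have i12 : Integrable (fun ω => f ω ^ 2 - (2 * t) * (f ω * g ω)) M :=
      i1.sub (i3.const_mul _)
    simp_rw [e] at h0
    rw [integral_add i12 (i2.const_mul _), integral_sub i1 (i3.const_mul _),
      integral_const_mul, integral_const_mul] at h0
    linarith
  have := discrim_le_zero key
  rw [discrim] at this
  linarith

theorem ae_integral_eq_zero_of_setIntegral {μ : Measure 𝒳} {ν : Measure 𝒴}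
    [IsProbabilityMeasure μ] [IsProbabilityMeasure ν] {K : 𝒳 × 𝒴 → ℝ}
    (hK : Integrable K (μ.prod ν))
    (h : ∀ s, MeasurableSet s → ∫ z in s ×ˢ Set.univ, K z ∂(μ.prod ν) = 0) :
    ∀ᵐ x ∂μ, ∫ y, K (x, y) ∂ν = 0 := by
  refine hK.integral_prod_left.ae_eq_zero_of_forall_setIntegral_eq_zero fun s hs _ => ?_
  have h1 := h s hs
  rw [setIntegral_prod _ hK.integrableOn] at h1
  simpa using h1

/-- A joint law with finite chi-square information has a density `1 + K` with respect to the
product of its marginals, where `K` is square integrable and doubly centered. -/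
theorem exists_centered_kernel (P : Measure (𝒳 × 𝒴)) [IsProbabilityMeasure P]
    (hP : chiSqInfo P ≠ ∞) :
    ∃ K : 𝒳 × 𝒴 → ℝ, Measurable K ∧ (∀ z, 0 ≤ 1 + K z) ∧ MemLp K 2 (P.fst.prod P.snd) ∧
      (∀ y, ∫ x, K (x, y) ∂P.fst = 0) ∧ (∀ x, ∫ y, K (x, y) ∂P.snd = 0) ∧
      P = (P.fst.prod P.snd).withDensity fun z => ENNReal.ofReal (1 + K z) := by
  set Q := P.fst.prod P.snd with hQ
  have hac : P ≪ Q := by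
    by_contra hac
    exact hP (by rw [chiSqInfo, chiSqDiv, if_neg hac])
  rw [chiSqInfo, chiSqDiv, if_pos hac] at hP
  set K₀ : 𝒳 × 𝒴 → ℝ := fun z => (P.rnDeriv Q z).toReal - 1 with hK₀
  have hLm : Measurable fun z => (P.rnDeriv Q z).toReal :=
    (Measure.measurable_rnDeriv P Q).ennreal_toReal
  have hK₀m : Measurable K₀ := hLm.sub_const 1
  have hK₀sq : Integrable (fun z => K₀ z ^ 2) Q := by
    refine ⟨(hK₀m.pow_const 2).aestronglyMeasurable, ?_⟩
    rw [hasFiniteIntegral_iff_ofReal (ae_of_all _ fun z => sq_nonneg _)]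
    exact lt_top_iff_ne_top.2 hP
  have hK₀L : MemLp K₀ 2 Q := (memLp_two_iff_integrable_sq hK₀m.aestronglyMeasurable).2 hK₀sq
  have hK₀i : Integrable K₀ Q := hK₀L.integrable (by norm_num)
  have hset : ∀ s, MeasurableSet s → Q.real s = P.real s → ∫ z in s, K₀ z ∂Q = 0 := by
    intro s _ h
    rw [hK₀, integral_sub Measure.integrable_toReal_rnDeriv.integrableOn
      (integrable_const _).integrableOn, Measure.setIntegral_toReal_rnDeriv hac]
    simp [h]
  have hX : ∀ᵐ x ∂P.fst, ∫ y, K₀ (x, y) ∂P.snd = 0 := by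
    refine ae_integral_eq_zero_of_setIntegral hK₀i fun s hs => hset _ (hs.prod .univ) ?_
    rw [Measure.real, Measure.real, hQ, Measure.prod_prod, measure_univ, mul_one,
      Measure.fst_apply hs, Set.prod_univ]
  have hY : ∀ᵐ y ∂P.snd, ∫ x, K₀ (x, y) ∂P.fst = 0 := by
    refine ae_integral_eq_zero_of_setIntegral (K := fun z => K₀ z.swap) hK₀i.swap fun s hs => ?_
    have h1 := hset (Set.univ ×ˢ s) (MeasurableSet.univ.prod hs) (by
      rw [Measure.real, Measure.real, hQ, Measure.prod_prod, measure_univ, one_mul,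
        Measure.snd_apply hs, Set.univ_prod])
    rw [← h1, hQ, ← setIntegral_prod_swap]
    simp only [Prod.swap_swap]
  set X₀ : Set 𝒳 := {x | ∫ y, K₀ (x, y) ∂P.snd = 0}
  set Y₀ : Set 𝒴 := {y | ∫ x, K₀ (x, y) ∂P.fst = 0}
  have hX₀ : MeasurableSet X₀ :=
    (hK₀m.stronglyMeasurable.integral_prod_right').measurable (measurableSet_singleton 0)
  have hY₀ : MeasurableSet Y₀ :=
    (hK₀m.stronglyMeasurable.integral_prod_left').measurable (measurableSet_singleton 0)
  -- The centered density `K₀` integrates to zero only along almost every section. Setting it to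
  -- zero off `X₀ ×ˢ Y₀` changes it on a null set and makes both identities hold for every section,
  -- as the resampling arguments require.
  set K : 𝒳 × 𝒴 → ℝ := (X₀ ×ˢ Y₀).indicator K₀ with hKdef
  have hKK : K =ᵐ[Q] K₀ := by
    have h1 : ∀ᵐ z ∂Q, z.1 ∈ X₀ :=
      (Measure.quasiMeasurePreserving_fst (μ := P.fst) (ν := P.snd)).ae hX
    have h2 : ∀ᵐ z ∂Q, z.2 ∈ Y₀ :=
      (Measure.quasiMeasurePreserving_snd (μ := P.fst) (ν := P.snd)).ae hY
    filter_upwards [h1, h2] with z h1 h2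
    exact Set.indicator_of_mem (Set.mk_mem_prod h1 h2) _
  refine ⟨K, hK₀m.indicator (hX₀.prod hY₀), fun z => ?_, (memLp_congr_ae hKK).2 hK₀L,
    fun y => ?_, fun x => ?_, ?_⟩
  · by_cases hz : z ∈ X₀ ×ˢ Y₀
    · rw [hKdef, Set.indicator_of_mem hz]
      simp [hK₀]
    · rw [hKdef, Set.indicator_of_notMem hz]
      norm_num
  · by_cases hy : y ∈ Y₀
    · refine Eq.trans (integral_congr_ae ?_) hy
      filter_upwards [hX] with x hx
      exact Set.indicator_of_mem (Set.mk_mem_prod (s := X₀) (t := Y₀) hx hy) _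
    · have : ∀ x, K (x, y) = 0 := fun x =>
        Set.indicator_of_notMem (fun h => hy h.2) _
      simp [this]
  · by_cases hx : x ∈ X₀
    · refine Eq.trans (integral_congr_ae ?_) hx
      filter_upwards [hY] with y hy
      exact Set.indicator_of_mem (Set.mk_mem_prod (s := X₀) (t := Y₀) hx hy) _
    · have : ∀ y, K (x, y) = 0 := fun y =>
        Set.indicator_of_notMem (fun h => hx h.1) _
      simp [this]
  · conv_lhs => rw [← Measure.withDensity_rnDeriv_eq P Q hac]
    refine withDensity_congr_ae ?_
    filter_upwards [hKK, Measure.rnDeriv_lt_top P Q] with z hz hlt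
    rw [hz, hK₀]
    simp [ENNReal.ofReal_toReal hlt.ne]

/-- The maximal correlation bounds the correlation of every normalized pair, and it is at
most one. -/
theorem integral_mul_le_maximalCorrelation (P : Measure (𝒳 × 𝒴)) [IsProbabilityMeasure P]
    {g : 𝒳 → ℝ} {h : 𝒴 → ℝ} (hg : Measurable g) (hh : Measurable h) (hg2 : MemLp g 2 P.fst)
    (hh2 : MemLp h 2 P.snd) (hg0 : ∫ x, g x ∂P.fst = 0) (hh0 : ∫ y, h y ∂P.snd = 0)
    (hg1 : ∫ x, g x ^ 2 ∂P.fst = 1) (hh1 : ∫ y, h y ^ 2 ∂P.snd = 1) :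
    ∫ p, g p.1 * h p.2 ∂P ≤ maximalCorrelation P := by
  refine le_csSup ⟨1, ?_⟩ ⟨g, h, hg, hh, hg2, hh2, hg0, hh0, hg1, hh1, rfl⟩
  rintro _ ⟨g, h, hg, hh, hg2, hh2, hg0, hh0, hg1, hh1, rfl⟩
  have h1 := (integral_sub_sq_of_normalized P hg hh hg2 hh2 hg0 hh0 hg1 hh1).2.2
  have h2 : 0 ≤ ∫ p, (g p.1 - h p.2) ^ 2 ∂P := integral_nonneg fun p => sq_nonneg _
  linarith

theorem maximalCorrelation_le_one (P : Measure (𝒳 × 𝒴)) [IsProbabilityMeasure P] :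
    maximalCorrelation P ≤ 1 := by
  refine Real.sSup_le ?_ zero_le_one
  rintro _ ⟨g, h, hg, hh, hg2, hh2, hg0, hh0, hg1, hh1, rfl⟩
  have h1 := (integral_sub_sq_of_normalized P hg hh hg2 hh2 hg0 hh0 hg1 hh1).2.2
  have h2 : 0 ≤ ∫ p, (g p.1 - h p.2) ^ 2 ∂P := integral_nonneg fun p => sq_nonneg _
  linarith

/-- An integral operator with square integrable kernel maps `L²` to `L²`. -/
theorem memLp_integral_kernel {μ : Measure 𝒳} {ν : Measure 𝒴} [IsProbabilityMeasure μ]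
    [IsProbabilityMeasure ν] {K : 𝒳 × 𝒴 → ℝ} (hK : Measurable K) (hK2 : MemLp K 2 (μ.prod ν))
    {b : 𝒳 → ℝ} (hb : Measurable b) (hb2 : MemLp b 2 μ) :
    MemLp (fun y => ∫ x, K (x, y) * b x ∂μ) 2 ν := by
  have hm : StronglyMeasurable fun y => ∫ x, K (x, y) * b x ∂μ :=
    StronglyMeasurable.integral_prod_left' (f := fun z : 𝒳 × 𝒴 => K z * b z.1)
      (hK.mul (hb.comp measurable_fst)).stronglyMeasurable
  rw [memLp_two_iff_integrable_sq hm.aestronglyMeasurable]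
  have hi : Integrable (fun y => (∫ x, K (x, y) ^ 2 ∂μ) * ∫ x, b x ^ 2 ∂μ) ν :=
    hK2.integrable_sq.integral_prod_right.mul_const _
  refine hi.mono' (hm.measurable.pow_const 2).aestronglyMeasurable ?_
  filter_upwards [hK2.integrable_sq.prod_left_ae] with y hy
  rw [Real.norm_eq_abs, abs_of_nonneg (sq_nonneg _)]
  refine sq_integral_mul_le ?_ hb2
  exact (memLp_two_iff_integrable_sq
    (hK.comp (measurable_id.prodMk measurable_const)).aestronglyMeasurable).2 hy

/-- The squared maximal correlation bounds the squared operator norm of the centered kernel. -/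
theorem integral_sq_integral_kernel_le (P : Measure (𝒳 × 𝒴)) [IsProbabilityMeasure P]
    {K : 𝒳 × 𝒴 → ℝ} (hK : Measurable K) (hK0 : ∀ z, 0 ≤ 1 + K z)
    (hK2 : MemLp K 2 (P.fst.prod P.snd)) (hX : ∀ y, ∫ x, K (x, y) ∂P.fst = 0)
    (hY : ∀ x, ∫ y, K (x, y) ∂P.snd = 0)
    (hP : P = (P.fst.prod P.snd).withDensity fun z => ENNReal.ofReal (1 + K z))
    {b : 𝒳 → ℝ} (hb : Measurable b) (hb2 : MemLp b 2 P.fst) :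
    ∫ y, (∫ x, K (x, y) * b x ∂P.fst) ^ 2 ∂P.snd ≤
      max (maximalCorrelation P) 0 ^ 2 * ∫ x, b x ^ 2 ∂P.fst := by
  set μ := P.fst with hμ
  set ν := P.snd with hν
  -- The image of b under the operator is itself the test function: with g the centered b, one has
  -- E_P[g h] = ‖h‖², hence ‖h‖² ≤ ρ ‖g‖ ‖h‖.
  set h : 𝒴 → ℝ := fun y => ∫ x, K (x, y) * b x ∂μ with hh
  have hhm : Measurable h := (StronglyMeasurable.integral_prod_left'
    (f := fun z : 𝒳 × 𝒴 => K z * b z.1) (hK.mul (hb.comp measurable_fst)).stronglyMeasurable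
    ).measurable
  have hh2 : MemLp h 2 ν := memLp_integral_kernel hK hK2 hb hb2
  have mp1 : MeasurePreserving Prod.fst (μ.prod ν) μ := measurePreserving_fst
  have mp2 : MeasurePreserving Prod.snd (μ.prod ν) ν := measurePreserving_snd
  set c := ∫ x, b x ∂μ with hc
  set g : 𝒳 → ℝ := fun x => b x - c with hg
  have hgm : Measurable g := hb.sub_const c
  have hg2 : MemLp g 2 μ := hb2.sub (memLp_const c)
  have hbi : Integrable b μ := hb2.integrable (by norm_num)
  have hg0 : ∫ x, g x ∂μ = 0 := by
    rw [hg, integral_sub hbi (integrable_const _)]; simp [hc]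
  set A := ∫ x, g x ^ 2 ∂μ with hA
  set H := ∫ y, h y ^ 2 ∂ν with hH
  have hA0 : 0 ≤ A := integral_nonneg fun x => sq_nonneg _
  have hH0 : 0 ≤ H := integral_nonneg fun x => sq_nonneg _
  have hAb : A ≤ ∫ x, b x ^ 2 ∂μ := by
    have e : ∀ x, g x ^ 2 = (b x ^ 2 - (2 * c) * b x) + c ^ 2 := fun x => by
      simp only [hg]; ring
    have i1 : Integrable (fun x => b x ^ 2 - (2 * c) * b x) μ :=
      hb2.integrable_sq.sub (hbi.const_mul _)
    rw [hA]
    simp_rw [e]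
    rw [integral_add i1 (integrable_const _), integral_sub hb2.integrable_sq (hbi.const_mul _),
      integral_const_mul, ← hc]
    simp only [integral_const, probReal_univ, one_smul]
    nlinarith [sq_nonneg c]
  have hKb : Integrable (fun z : 𝒳 × 𝒴 => K z * b z.1) (μ.prod ν) :=
    hK2.integrable_mul (hb2.comp_measurePreserving mp1)
  have hh0 : ∫ y, h y ∂ν = 0 := by
    rw [hh, ← integral_prod_symm _ hKb, integral_prod _ hKb]
    simp [integral_mul_const, hY]
  have hKi : Integrable K (μ.prod ν) := hK2.integrable (by norm_num)
  have hhg : ∀ᵐ y ∂ν, ∫ x, K (x, y) * g x ∂μ = h y := by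
    filter_upwards [hKi.prod_left_ae, hKb.prod_left_ae] with y h1 h2
    simp only [hg, mul_sub]
    rw [integral_sub h2 (h1.mul_const c), integral_mul_const, hX, zero_mul, sub_zero]
  have hgh : MemLp (fun z : 𝒳 × 𝒴 => g z.1 * h z.2) 2 (μ.prod ν) := by
    have hm : Measurable fun z : 𝒳 × 𝒴 => g z.1 * h z.2 := by fun_prop
    rw [memLp_two_iff_integrable_sq hm.aestronglyMeasurable]
    simp_rw [mul_pow]
    exact hg2.integrable_sq.mul_prod hh2.integrable_sq
  have hKgh : Integrable (fun z : 𝒳 × 𝒴 => K z * (g z.1 * h z.2)) (μ.prod ν) :=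
    hK2.integrable_mul hgh
  have hKH : ∫ z : 𝒳 × 𝒴, K z * (g z.1 * h z.2) ∂(μ.prod ν) = H := by
    rw [integral_prod_symm _ hKgh, hH]
    refine integral_congr_ae ?_
    filter_upwards [hhg] with y hy
    rw [pow_two, ← hy, ← integral_mul_const, hy]
    simp only [mul_assoc]
  have hPgh : ∫ z, g z.1 * h z.2 ∂P = H := by
    rw [hP, integral_withDensity_eq_integral_toReal_smul (by fun_prop)
      (ae_of_all _ fun z => ENNReal.ofReal_lt_top)]
    simp_rw [fun z => ENNReal.toReal_ofReal (hK0 z), smul_eq_mul, add_mul, one_mul]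
    rw [integral_add (hgh.integrable (by norm_num)) hKgh, hKH, integral_prod_mul, hg0]
    simp
  rcases hH0.eq_or_lt with hz | hHpos
  · rw [← hz]
    exact mul_nonneg (sq_nonneg _) (integral_nonneg fun x => sq_nonneg _)
  -- Normalization divides by √A. If A = 0, then g = 0 almost everywhere, so h vanishes almost
  -- everywhere, against H > 0.
  have hApos : 0 < A := by
    refine hA0.lt_of_ne fun hz => ?_
    have h1 := (integral_eq_zero_iff_of_nonneg (fun x => sq_nonneg (g x)) hg2.integrable_sq).1
      hz.symm
    have h2 : ∀ y, ∫ x, K (x, y) * g x ∂μ = 0 := fun y => by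
      refine integral_eq_zero_of_ae ?_
      filter_upwards [h1] with x hx
      have : g x = 0 := by simpa using hx
      simp [this]
    have h3 : H = 0 := by
      refine integral_eq_zero_of_ae ?_
      filter_upwards [hhg] with y hy
      rw [← hy, h2 y]
      simp
    exact hHpos.ne' h3
  have sA : 0 < Real.sqrt A := Real.sqrt_pos.2 hApos
  have sH : 0 < Real.sqrt H := Real.sqrt_pos.2 hHpos
  have hmax := integral_mul_le_maximalCorrelation P (g := fun x => g x / Real.sqrt A)
    (h := fun y => h y / Real.sqrt H) (hgm.div_const _) (hhm.div_const _)
    (by simpa only [div_eq_mul_inv] using hg2.mul_const _)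
    (by simpa only [div_eq_mul_inv] using hh2.mul_const _)
    (by rw [integral_div, hg0, zero_div]) (by rw [integral_div, hh0, zero_div])
    (by simp_rw [div_pow, Real.sq_sqrt hA0]; rw [integral_div]; exact div_self hApos.ne')
    (by simp_rw [div_pow, Real.sq_sqrt hH0]; rw [integral_div]; exact div_self hHpos.ne')
  simp_rw [div_mul_div_comm] at hmax
  rw [integral_div, hPgh, div_le_iff₀ (by positivity)] at hmax
  have h4 : H ≤ max (maximalCorrelation P) 0 * (Real.sqrt A * Real.sqrt H) :=
    hmax.trans (mul_le_mul_of_nonneg_right (le_max_left _ _) (by positivity))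
  have h5 : Real.sqrt H ≤ max (maximalCorrelation P) 0 * Real.sqrt A := by
    refine le_of_mul_le_mul_right ?_ sH
    rw [Real.mul_self_sqrt hH0]
    linarith
  calc H = Real.sqrt H ^ 2 := (Real.sq_sqrt hH0).symm
    _ ≤ (max (maximalCorrelation P) 0 * Real.sqrt A) ^ 2 := pow_le_pow_left₀ sH.le h5 2
    _ = max (maximalCorrelation P) 0 ^ 2 * A := by rw [mul_pow, Real.sq_sqrt hA0]
    _ ≤ _ := by gcongr

end Kernel

theorem integral_comp_of_measurePreserving {Ω Ω' : Type*} [MeasurableSpace Ω]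
    [MeasurableSpace Ω'] {M : Measure Ω} {M' : Measure Ω'} {φ : Ω → Ω'}
    (h : MeasurePreserving φ M M') {f : Ω' → ℝ} (hf : AEStronglyMeasurable f M') :
    ∫ ω, f (φ ω) ∂M = ∫ ω, f ω ∂M' := by
  rw [← h.map_eq, integral_map h.measurable.aemeasurable (by rwa [h.map_eq])]

/-! ### Resampling entries of two independent families -/

section Resampling

variable {ι κ 𝒳 𝒴 : Type*} [Fintype ι] [Fintype κ] [MeasurableSpace 𝒳]
  [MeasurableSpace 𝒴] (μ : Measure 𝒳) (ν : Measure 𝒴)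
  [IsProbabilityMeasure μ] [IsProbabilityMeasure ν]

/-- All entries of two families are independent, with laws `μ` and `ν`. -/
noncomputable def indepLaw (ι κ : Type*) [Fintype ι] [Fintype κ] (μ : Measure 𝒳)
    (ν : Measure 𝒴) : Measure ((ι → 𝒳) × (κ → 𝒴)) :=
  (Measure.pi fun _ => μ).prod (Measure.pi fun _ => ν)

instance : IsProbabilityMeasure (indepLaw ι κ μ ν) := by
  unfold indepLaw; infer_instance

theorem measurePreserving_update_left [DecidableEq ι] (j : ι) :
    MeasurePreserving (fun p : ((ι → 𝒳) × (κ → 𝒴)) × 𝒳 => (Function.update p.1.1 j p.2, p.1.2))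
      ((indepLaw ι κ μ ν).prod μ) (indepLaw ι κ μ ν) := by
  have h1 := (measurePreserving_update μ j).prod
    (MeasurePreserving.id (Measure.pi fun _ : κ => ν))
  have h2 : MeasurePreserving
      (fun p : ((ι → 𝒳) × (κ → 𝒴)) × 𝒳 => ((p.1.1, p.2), p.1.2))
      (((Measure.pi fun _ : ι => μ).prod (Measure.pi fun _ : κ => ν)).prod μ)
      (((Measure.pi fun _ : ι => μ).prod μ).prod (Measure.pi fun _ : κ => ν)) := by
    have a1 := measurePreserving_prodAssoc (Measure.pi fun _ : ι => μ)
      (Measure.pi fun _ : κ => ν) μ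
    have a2 := (MeasurePreserving.id (Measure.pi fun _ : ι => μ)).prod
      (Measure.measurePreserving_swap (μ := (Measure.pi fun _ : κ => ν)) (ν := μ))
    have a3 := (measurePreserving_prodAssoc (Measure.pi fun _ : ι => μ) μ
      (Measure.pi fun _ : κ => ν)).symm
    exact a3.comp (a2.comp a1)
  exact h1.comp h2

theorem measurePreserving_update_right [DecidableEq κ] (i : κ) :
    MeasurePreserving (fun p : ((ι → 𝒳) × (κ → 𝒴)) × 𝒴 => (p.1.1, Function.update p.1.2 i p.2))
      ((indepLaw ι κ μ ν).prod ν) (indepLaw ι κ μ ν) := by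
  have h1 := (MeasurePreserving.id (Measure.pi fun _ : ι => μ)).prod
    (measurePreserving_update ν i)
  exact h1.comp (measurePreserving_prodAssoc (Measure.pi fun _ : ι => μ)
      (Measure.pi fun _ : κ => ν) ν)

/-- Reindexing both families along injections. -/
theorem measurePreserving_comp_indepLaw {ι' κ' : Type*} [Fintype ι'] [Fintype κ']
    {e : ι' → ι} {e' : κ' → κ} (he : Function.Injective e) (he' : Function.Injective e') :
    MeasurePreserving (fun d : (ι → 𝒳) × (κ → 𝒴) => (d.1 ∘ e, d.2 ∘ e'))
      (indepLaw ι κ μ ν) (indepLaw ι' κ' μ ν) :=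
  (measurePreserving_comp_injective μ he).prod (measurePreserving_comp_injective ν he')

theorem integral_indepLaw_eq_zero_left [DecidableEq ι] (j : ι) {F : (ι → 𝒳) × (κ → 𝒴) → ℝ}
    (hF : ∀ d : (ι → 𝒳) × (κ → 𝒴), ∫ u, F (Function.update d.1 j u, d.2) ∂μ = 0) :
    ∫ d, F d ∂(indepLaw ι κ μ ν) = 0 := by
  by_cases hi : Integrable F (indepLaw ι κ μ ν)
  · have mp := measurePreserving_update_left (κ := κ) μ ν j
    have h1 := mp.integrable_comp_of_integrable hi
    rw [← mp.map_eq, integral_map mp.measurable.aemeasurable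
      (by rw [mp.map_eq]; exact hi.aestronglyMeasurable)]
    refine (integral_prod _ h1).trans ?_
    simp [hF]
  · exact integral_undef hi

theorem integral_indepLaw_eq_zero_right [DecidableEq κ] (i : κ) {F : (ι → 𝒳) × (κ → 𝒴) → ℝ}
    (hF : ∀ d : (ι → 𝒳) × (κ → 𝒴), ∫ t, F (d.1, Function.update d.2 i t) ∂ν = 0) :
    ∫ d, F d ∂(indepLaw ι κ μ ν) = 0 := by
  by_cases hi : Integrable F (indepLaw ι κ μ ν)
  · have mp := measurePreserving_update_right (ι := ι) μ ν i
    have h1 := mp.integrable_comp_of_integrable hi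
    rw [← mp.map_eq, integral_map mp.measurable.aemeasurable
      (by rw [mp.map_eq]; exact hi.aestronglyMeasurable)]
    refine (integral_prod _ h1).trans ?_
    simp [hF]
  · exact integral_undef hi

/-- Integration of a function of one entry of each family and of a function that does not depend
on these two entries. -/
theorem integral_mul_of_separated [DecidableEq ι] [DecidableEq κ] (j : ι) (i : κ)
    {G : 𝒳 × 𝒴 → ℝ} {F : (ι → 𝒳) × (κ → 𝒴) → ℝ}
    (hi : Integrable (fun d : (ι → 𝒳) × (κ → 𝒴) => G (d.1 j, d.2 i) * F d) (indepLaw ι κ μ ν))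
    (hG : Integrable G (μ.prod ν))
    (hF : ∀ (d : (ι → 𝒳) × (κ → 𝒴)) (u : 𝒳) (t : 𝒴),
      F (Function.update d.1 j u, Function.update d.2 i t) = F d) :
    ∫ d, G (d.1 j, d.2 i) * F d ∂(indepLaw ι κ μ ν) =
      (∫ z, G z ∂(μ.prod ν)) * ∫ d, F d ∂(indepLaw ι κ μ ν) := by
  have mp := (measurePreserving_update_left (κ := κ) μ ν j).comp
    ((measurePreserving_update_right (ι := ι) μ ν i).prod (MeasurePreserving.id μ))
  have h1 := mp.integrable_comp_of_integrable hi
  have h2 : ∀ q : (((ι → 𝒳) × (κ → 𝒴)) × 𝒴) × 𝒳,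
      F (Function.update q.1.1.1 j q.2, Function.update q.1.1.2 i q.1.2) = F q.1.1 :=
    fun q => hF _ _ _
  have e1 := integral_map mp.measurable.aemeasurable
    (f := fun d : (ι → 𝒳) × (κ → 𝒴) => G (d.1 j, d.2 i) * F d)
    (by rw [mp.map_eq]; exact hi.aestronglyMeasurable)
  rw [mp.map_eq] at e1
  rw [e1]
  simp only [Function.comp_def, Prod.map, id, Function.update_self, h2] at h1 ⊢
  rw [integral_prod _ h1, integral_prod _ h1.integral_prod_left, integral_prod_symm _ hG]
  simp only [integral_mul_const, integral_const_mul]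

end Resampling

/-! ### Second moments of permanents of random kernel matrices -/

section Permanent

variable {𝒳 𝒴 : Type*}

/-- The permanent of the matrix `K (x i, y j)`. -/
noncomputable def kernelPermanent (K : 𝒳 × 𝒴 → ℝ) (s : ℕ) (d : (Fin s → 𝒳) × (Fin s → 𝒴)) : ℝ :=
  ∑ σ : Equiv.Perm (Fin s), ∏ i, K (d.1 (σ i), d.2 i)

/-- Laplace expansion along the Y-index 0: a permutation is the image j of 0 together with a
permutation of the rest, and `swap 0 j ∘ succ` enumerates the X-indices other than j. -/
theorem kernelPermanent_succ (K : 𝒳 × 𝒴 → ℝ) (s : ℕ)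
    (d : (Fin (s + 1) → 𝒳) × (Fin (s + 1) → 𝒴)) :
    kernelPermanent K (s + 1) d = ∑ j, K (d.1 j, d.2 0) *
      kernelPermanent K s (d.1 ∘ (fun i : Fin s => Equiv.swap 0 j i.succ), d.2 ∘ Fin.succ) := by
  unfold kernelPermanent
  rw [← Equiv.Perm.decomposeFin.symm.sum_comp, Fintype.sum_prod_type]
  refine Finset.sum_congr rfl fun j _ => ?_
  rw [Finset.mul_sum]
  refine Finset.sum_congr rfl fun σ _ => ?_
  rw [Fin.prod_univ_succ]
  simp

variable [MeasurableSpace 𝒳] [MeasurableSpace 𝒴]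

theorem measurable_kernelPermanent {K : 𝒳 × 𝒴 → ℝ} (hK : Measurable K) (s : ℕ) :
    Measurable (kernelPermanent K s) := by
  unfold kernelPermanent; fun_prop

variable {μ : Measure 𝒳} {ν : Measure 𝒴} [IsProbabilityMeasure μ] [IsProbabilityMeasure ν]
  {K : 𝒳 × 𝒴 → ℝ}

/-- Products of kernel values at distinct entries are square integrable. -/
theorem memLp_prod_kernel {ι κ τ : Type*} [Fintype ι] [Fintype κ] [Fintype τ]
    (hK : Measurable K) (hK2 : MemLp K 2 (μ.prod ν)) {e : τ → ι} {e' : τ → κ}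
    (he : Function.Injective e) (he' : Function.Injective e') :
    MemLp (fun d : (ι → 𝒳) × (κ → 𝒴) => ∏ k, K (d.1 (e k), d.2 (e' k))) 2
      (indepLaw ι κ μ ν) := by
  have mp1 := measurePreserving_comp_indepLaw μ ν he he'
  have mp2 : MeasurePreserving (MeasurableEquiv.arrowProdEquivProdArrow 𝒳 𝒴 τ).symm
      (indepLaw τ τ μ ν) (Measure.pi fun _ => μ.prod ν) :=
    (measurePreserving_arrowProdEquivProdArrow 𝒳 𝒴 τ (fun _ => μ) (fun _ => ν)).symm
  have h : MemLp (fun w : τ → 𝒳 × 𝒴 => ∏ k, K (w k)) 2 (Measure.pi fun _ => μ.prod ν) := by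
    have hm : Measurable fun w : τ → 𝒳 × 𝒴 => ∏ k, K (w k) := by fun_prop
    rw [memLp_two_iff_integrable_sq hm.aestronglyMeasurable]
    simp_rw [← Finset.prod_pow]
    exact Integrable.fintype_prod fun _ => hK2.integrable_sq
  exact h.comp_measurePreserving (mp2.comp mp1)

theorem memLp_kernelPermanent (hK : Measurable K) (hK2 : MemLp K 2 (μ.prod ν)) (s : ℕ) :
    MemLp (kernelPermanent K s) 2 (indepLaw (Fin s) (Fin s) μ ν) := by
  unfold kernelPermanent
  exact memLp_finsetSum _ fun σ _ => memLp_prod_kernel hK hK2 σ.injective Function.injective_id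

/-- Two kernel factors that share one `Y`-entry are integrated out by the operator bound. -/
theorem integral_mul_le_of_operator_bound {ι κ : Type*} [Fintype ι] [Fintype κ] [DecidableEq ι]
    [DecidableEq κ] (hK : Measurable K) (hK2 : MemLp K 2 (μ.prod ν)) {r : ℝ}
    (hr : ∀ b : 𝒳 → ℝ, Measurable b → MemLp b 2 μ →
      ∫ y, (∫ x, K (x, y) * b x ∂μ) ^ 2 ∂ν ≤ r * ∫ x, b x ^ 2 ∂μ)
    {j k : ι} (hjk : j ≠ k) (i : κ) {a b : (ι → 𝒳) × (κ → 𝒴) → ℝ} (ham : Measurable a)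
    (hbm : Measurable b) (ha2 : MemLp a 2 (indepLaw ι κ μ ν)) (hb2 : MemLp b 2 (indepLaw ι κ μ ν))
    (ha : ∀ (d : (ι → 𝒳) × (κ → 𝒴)) (u : 𝒳) (t : 𝒴),
      a (Function.update d.1 j u, Function.update d.2 i t) = a d)
    (hb : ∀ (d : (ι → 𝒳) × (κ → 𝒴)) (u : 𝒳) (t : 𝒴),
      b (Function.update d.1 k u, Function.update d.2 i t) = b d)
    (hi : Integrable (fun d : (ι → 𝒳) × (κ → 𝒴) =>
      K (d.1 j, d.2 i) * a d * (K (d.1 k, d.2 i) * b d)) (indepLaw ι κ μ ν)) :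
    ∫ d, K (d.1 j, d.2 i) * a d * (K (d.1 k, d.2 i) * b d) ∂(indepLaw ι κ μ ν) ≤
      r / 2 * (∫ d, a d ^ 2 ∂(indepLaw ι κ μ ν) + ∫ d, b d ^ 2 ∂(indepLaw ι κ μ ν)) := by
  have mpj := measurePreserving_update_left (κ := κ) μ ν j
  have mpk := measurePreserving_update_left (κ := κ) μ ν k
  -- Resample Y_i, X_j and X_k as t, u, v. Then a sees only v and b only u, so for fixed t the
  -- integral over u and v factors into two values of the operator (`hfact`). The mean of squares
  -- and the operator bound finish.
  have mp := mpk.comp ((mpj.comp ((measurePreserving_update_right (ι := ι) μ ν i).prod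
    (MeasurePreserving.id μ))).prod (MeasurePreserving.id μ))
  have h1 := mp.integrable_comp_of_integrable hi
  have e1 := integral_map mp.measurable.aemeasurable
    (f := fun d : (ι → 𝒳) × (κ → 𝒴) => K (d.1 j, d.2 i) * a d * (K (d.1 k, d.2 i) * b d))
    (by rw [mp.map_eq]; exact hi.aestronglyMeasurable)
  rw [mp.map_eq] at e1
  rw [e1]
  have ha' : ∀ (d : (ι → 𝒳) × (κ → 𝒴)) (u v : 𝒳) (t : 𝒴),
      a (Function.update (Function.update d.1 j u) k v, Function.update d.2 i t) =
        a (Function.update d.1 k v, d.2) := fun d u v t => by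
    rw [Function.update_comm hjk]
    exact ha (Function.update d.1 k v, d.2) u t
  have hb' : ∀ (d : (ι → 𝒳) × (κ → 𝒴)) (u v : 𝒳) (t : 𝒴),
      b (Function.update (Function.update d.1 j u) k v, Function.update d.2 i t) =
        b (Function.update d.1 j u, d.2) := fun d u v t =>
    hb (Function.update d.1 j u, d.2) v t
  simp only [Function.comp_def, Prod.map, id, Function.update_self, ha', hb',
    Function.update_of_ne hjk] at h1 ⊢
  rw [integral_prod _ h1, integral_prod _ h1.integral_prod_left,
    integral_prod _ h1.integral_prod_left.integral_prod_left]
  have iL := h1.integral_prod_left.integral_prod_left.integral_prod_left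
  simp only at iL ⊢
  have ia := mpk.integrable_comp_of_integrable ha2.integrable_sq
  have ib := mpj.integrable_comp_of_integrable hb2.integrable_sq
  simp only [Function.comp_def] at ia ib
  have ea : ∫ d, ∫ v, a (Function.update d.1 k v, d.2) ^ 2 ∂μ ∂(indepLaw ι κ μ ν) =
      ∫ d, a d ^ 2 ∂(indepLaw ι κ μ ν) := by
    rw [← integral_prod _ ia]
    exact integral_comp_of_measurePreserving mpk (ha2.integrable_sq.aestronglyMeasurable)
  have eb : ∫ d, ∫ v, b (Function.update d.1 j v, d.2) ^ 2 ∂μ ∂(indepLaw ι κ μ ν) =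
      ∫ d, b d ^ 2 ∂(indepLaw ι κ μ ν) := by
    rw [← integral_prod _ ib]
    exact integral_comp_of_measurePreserving mpj (hb2.integrable_sq.aestronglyMeasurable)
  rw [← ea, ← eb, ← integral_add ia.integral_prod_left ib.integral_prod_left,
    ← integral_const_mul]
  refine integral_mono_ae iL ((ia.integral_prod_left.add ib.integral_prod_left).const_mul _) ?_
  filter_upwards [ia.prod_right_ae, ib.prod_right_ae] with d hda hdb
  have hma : Measurable fun v => a (Function.update d.1 k v, d.2) :=
    ham.comp ((measurable_update d.1).prodMk measurable_const)
  have hmb : Measurable fun v => b (Function.update d.1 j v, d.2) :=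
    hbm.comp ((measurable_update d.1).prodMk measurable_const)
  have La := (memLp_two_iff_integrable_sq hma.aestronglyMeasurable).2 hda
  have Lb := (memLp_two_iff_integrable_sq hmb.aestronglyMeasurable).2 hdb
  have Ma := memLp_integral_kernel hK hK2 hma La
  have Mb := memLp_integral_kernel hK hK2 hmb Lb
  have hA := hr _ hma La
  have hB := hr _ hmb Lb
  set φ := fun y => ∫ x, K (x, y) * a (Function.update d.1 k x, d.2) ∂μ with hφ
  set ψ := fun y => ∫ x, K (x, y) * b (Function.update d.1 j x, d.2) ∂μ with hψ
  have hfact : ∀ t, ∫ u, ∫ v, K (u, t) * a (Function.update d.1 k v, d.2) *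
      (K (v, t) * b (Function.update d.1 j u, d.2)) ∂μ ∂μ = ψ t * φ t := by
    intro t
    have e : ∀ u v, K (u, t) * a (Function.update d.1 k v, d.2) *
        (K (v, t) * b (Function.update d.1 j u, d.2)) =
        (K (u, t) * b (Function.update d.1 j u, d.2)) *
          (K (v, t) * a (Function.update d.1 k v, d.2)) := fun u v => by ring
    simp_rw [e, integral_const_mul, integral_mul_const]
    rfl
  simp_rw [hfact]
  have hle : ∫ t, ψ t * φ t ∂ν ≤ ∫ t, (φ t ^ 2 / 2 + ψ t ^ 2 / 2) ∂ν := by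
    refine integral_mono (Mb.integrable_mul Ma)
      ((Ma.integrable_sq.div_const 2).add (Mb.integrable_sq.div_const 2)) fun t => ?_
    simp only
    nlinarith [sq_nonneg (φ t - ψ t)]
  rw [integral_add (Ma.integrable_sq.div_const 2) (Mb.integrable_sq.div_const 2), integral_div,
    integral_div] at hle
  linarith

/-- The recursive bound for the second moment of the permanent of a random kernel matrix. -/
theorem integral_kernelPermanent_succ_sq_le (hK : Measurable K) (hK2 : MemLp K 2 (μ.prod ν))
    {r : ℝ} (hr : ∀ b : 𝒳 → ℝ, Measurable b → MemLp b 2 μ →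
      ∫ y, (∫ x, K (x, y) * b x ∂μ) ^ 2 ∂ν ≤ r * ∫ x, b x ^ 2 ∂μ) (s : ℕ) :
    ∫ d, kernelPermanent K (s + 1) d ^ 2 ∂(indepLaw (Fin (s + 1)) (Fin (s + 1)) μ ν) ≤
      (s + 1) * (∫ z, K z ^ 2 ∂(μ.prod ν) + r * s) *
        ∫ d, kernelPermanent K s d ^ 2 ∂(indepLaw (Fin s) (Fin s) μ ν) := by
  set N := indepLaw (Fin (s + 1)) (Fin (s + 1)) μ ν with hN
  set q := ∫ d, kernelPermanent K s d ^ 2 ∂(indepLaw (Fin s) (Fin s) μ ν) with hq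
  set e : Fin (s + 1) → Fin s → Fin (s + 1) := fun j i => Equiv.swap 0 j i.succ with he
  have hej : ∀ j, Function.Injective (e j) := fun j =>
    (Equiv.injective _).comp (Fin.succ_injective s)
  have hne : ∀ j i, e j i ≠ j := fun j i h => by
    have h2 := congrArg (Equiv.swap 0 j) h
    simp only [he, Equiv.swap_apply_self, Equiv.swap_apply_right] at h2
    exact Fin.succ_ne_zero i h2
  set a : Fin (s + 1) → (Fin (s + 1) → 𝒳) × (Fin (s + 1) → 𝒴) → ℝ :=
    fun j d => kernelPermanent K s (d.1 ∘ e j, d.2 ∘ Fin.succ) with ha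
  have mp : ∀ j, MeasurePreserving
      (fun d : (Fin (s + 1) → 𝒳) × (Fin (s + 1) → 𝒴) => (d.1 ∘ e j, d.2 ∘ Fin.succ)) N
      (indepLaw (Fin s) (Fin s) μ ν) := fun j =>
    measurePreserving_comp_indepLaw μ ν (hej j) (Fin.succ_injective s)
  have hDm := measurable_kernelPermanent hK s
  have ham : ∀ j, Measurable (a j) := fun j => hDm.comp (mp j).measurable
  have ha2 : ∀ j, MemLp (a j) 2 N := fun j =>
    (memLp_kernelPermanent hK hK2 s).comp_measurePreserving (mp j)
  have haq : ∀ j, ∫ d, a j d ^ 2 ∂N = q := fun j =>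
    integral_comp_of_measurePreserving (mp j) (f := fun d => kernelPermanent K s d ^ 2)
      (hDm.pow_const 2).aestronglyMeasurable
  have hinv : ∀ j (d : (Fin (s + 1) → 𝒳) × (Fin (s + 1) → 𝒴)) (u : 𝒳) (t : 𝒴),
      a j (Function.update d.1 j u, Function.update d.2 0 t) = a j d := by
    intro j d u t
    refine congrArg (kernelPermanent K s) (Prod.ext (funext fun i => ?_) (funext fun i => ?_))
    · simp [Function.update_of_ne (hne j i)]
    · simp
  have hG : ∀ j, MemLp (fun d : (Fin (s + 1) → 𝒳) × (Fin (s + 1) → 𝒴) =>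
      K (d.1 j, d.2 0) * a j d) 2 N := by
    intro j
    have : (fun d : (Fin (s + 1) → 𝒳) × (Fin (s + 1) → 𝒴) => K (d.1 j, d.2 0) * a j d) =
        fun d => ∑ σ : Equiv.Perm (Fin s), ∏ i : Fin (s + 1),
          K (d.1 (Equiv.Perm.decomposeFin.symm (j, σ) i), d.2 i) := by
      funext d
      simp only [ha, kernelPermanent, Finset.mul_sum]
      refine Finset.sum_congr rfl fun σ _ => ?_
      rw [Fin.prod_univ_succ]
      simp [he]
    rw [this]
    exact memLp_finsetSum _ fun σ _ =>
      memLp_prod_kernel hK hK2 (Equiv.injective _) Function.injective_id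
  have hint : ∀ j k, Integrable (fun d : (Fin (s + 1) → 𝒳) × (Fin (s + 1) → 𝒴) =>
      K (d.1 j, d.2 0) * a j d * (K (d.1 k, d.2 0) * a k d)) N := fun j k =>
    (hG j).integrable_mul (hG k)
  have hdiag : ∀ j, ∫ d, K (d.1 j, d.2 0) * a j d * (K (d.1 j, d.2 0) * a j d) ∂N =
      (∫ z, K z ^ 2 ∂(μ.prod ν)) * q := by
    intro j
    have e2 : ∀ d : (Fin (s + 1) → 𝒳) × (Fin (s + 1) → 𝒴),
        K (d.1 j, d.2 0) * a j d * (K (d.1 j, d.2 0) * a j d) =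
          (fun z => K z ^ 2) (d.1 j, d.2 0) * a j d ^ 2 := fun d => by ring
    rw [← haq j]
    have := hint j j
    simp_rw [e2] at this ⊢
    exact integral_mul_of_separated μ ν j 0 this hK2.integrable_sq
      fun d u t => by rw [hinv]
  have hoff : ∀ j k, j ≠ k →
      ∫ d, K (d.1 j, d.2 0) * a j d * (K (d.1 k, d.2 0) * a k d) ∂N ≤ r * q := by
    intro j k hjk
    have h := integral_mul_le_of_operator_bound hK hK2 hr hjk 0 (ham j) (ham k) (ha2 j) (ha2 k)
      (hinv j) (hinv k) (hint j k)
    have hj := haq j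
    have hk := haq k
    rw [hN] at hj hk
    rw [hj, hk] at h
    linarith
  calc ∫ d, kernelPermanent K (s + 1) d ^ 2 ∂N
      = ∑ j, ∑ k, ∫ d, K (d.1 j, d.2 0) * a j d * (K (d.1 k, d.2 0) * a k d) ∂N := by
        simp_rw [kernelPermanent_succ, pow_two, Finset.sum_mul_sum]
        rw [integral_finsetSum _ fun j _ => integrable_finsetSum _ fun k _ => hint j k]
        exact Finset.sum_congr rfl fun j _ => integral_finsetSum _ fun k _ => hint j k
    -- Every pair (j, k) is charged r q, and the s + 1 diagonal pairs are corrected to I q, where I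
    -- is the second moment of K; the total is (s + 1)(I + r s) q.
    _ ≤ ∑ j : Fin (s + 1), ∑ k : Fin (s + 1),
          (if k = j then (∫ z, K z ^ 2 ∂(μ.prod ν)) * q - r * q else 0) +
            ∑ j : Fin (s + 1), ∑ k : Fin (s + 1), r * q := by
        rw [← Finset.sum_add_distrib]
        refine Finset.sum_le_sum fun j _ => ?_
        rw [← Finset.sum_add_distrib]
        refine Finset.sum_le_sum fun k _ => ?_
        by_cases hjk : k = j
        · subst hjk
          rw [if_pos rfl, hdiag]
          linarith
        · rw [if_neg hjk, zero_add]
          exact hoff j k (Ne.symm hjk)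
    _ = (s + 1) * (∫ z, K z ^ 2 ∂(μ.prod ν) + r * s) * q := by
        simp only [Finset.sum_ite_eq', Finset.mem_univ, if_true, Finset.sum_const,
          Finset.card_univ, Fintype.card_fin, nsmul_eq_mul]
        push_cast
        ring

/-- Iterates the recursion. For r > 0 the bound is (s!)² rˢ up to a power of s, which is why r, and
not the second moment of K, decides convergence later. -/
theorem integral_kernelPermanent_sq_le (hK : Measurable K) (hK2 : MemLp K 2 (μ.prod ν))
    {r : ℝ} (hr0 : 0 ≤ r) (hr : ∀ b : 𝒳 → ℝ, Measurable b → MemLp b 2 μ →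
      ∫ y, (∫ x, K (x, y) * b x ∂μ) ^ 2 ∂ν ≤ r * ∫ x, b x ^ 2 ∂μ) (s : ℕ) :
    ∫ d, kernelPermanent K s d ^ 2 ∂(indepLaw (Fin s) (Fin s) μ ν) ≤
      s.factorial * ∏ i ∈ Finset.range s, (∫ z, K z ^ 2 ∂(μ.prod ν) + r * i) := by
  induction s with
  | zero => simp [kernelPermanent]
  | succ s ih =>
    have hI : 0 ≤ ∫ z, K z ^ 2 ∂(μ.prod ν) := integral_nonneg fun z => sq_nonneg _
    refine (integral_kernelPermanent_succ_sq_le hK hK2 hr s).trans ?_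
    refine (mul_le_mul_of_nonneg_left ih (by positivity)).trans (le_of_eq ?_)
    rw [Finset.prod_range_succ, Nat.factorial_succ]
    push_cast
    ring

end Permanent

/-! ### Averages over random embeddings -/

section Averaging

/-- Any two embeddings of one finite type differ by a permutation of the target. -/
theorem exists_perm_trans_eq {s n : ℕ} (ρ ρ' : Fin s ↪ Fin n) :
    ∃ σ : Equiv.Perm (Fin n), ρ' = ρ.trans σ.toEmbedding := by
  classical
  let e : {x // x ∈ Set.range ρ} ≃ {x // x ∈ Set.range ρ'} :=
    (Equiv.ofInjective ρ ρ.injective).symm.trans (Equiv.ofInjective ρ' ρ'.injective)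
  refine ⟨e.extendSubtype, ?_⟩
  ext k
  have h := e.extendSubtype_apply_of_mem (ρ k) ⟨k, rfl⟩
  have h2 : (Equiv.ofInjective ρ ρ.injective).symm ⟨ρ k, ⟨k, rfl⟩⟩ = k :=
    Equiv.ofInjective_symm_apply ρ.injective k
  simp only [Function.Embedding.trans_apply, Equiv.coe_toEmbedding]
  rw [h]
  simp [e]

theorem sum_perm_trans_eq {s n : ℕ} (g : (Fin s ↪ Fin n) → ℝ) (ρ ρ' : Fin s ↪ Fin n) :
    ∑ σ : Equiv.Perm (Fin n), g (ρ.trans σ.toEmbedding) =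
      ∑ σ : Equiv.Perm (Fin n), g (ρ'.trans σ.toEmbedding) := by
  obtain ⟨σ₀, rfl⟩ := exists_perm_trans_eq ρ ρ'
  exact (Equiv.sum_comp (Equiv.mulRight σ₀) fun σ => g (ρ.trans σ.toEmbedding)).symm

/-- Composing π with a permutation of the target merely reorders the sum over π, so one may also sum
over all permutations; that inner sum does not depend on the starting embedding. -/
theorem card_perm_mul_sum_embedding {m s n : ℕ} (ι : Fin s ↪ Fin m) (g : (Fin s ↪ Fin n) → ℝ)
    (ρ : Fin s ↪ Fin n) :
    (Fintype.card (Equiv.Perm (Fin n)) : ℝ) * ∑ π : Fin m ↪ Fin n, g (ι.trans π) =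
      Fintype.card (Fin m ↪ Fin n) *
        ∑ σ : Equiv.Perm (Fin n), g (ρ.trans σ.toEmbedding) := by
  have h1 : ∀ σ : Equiv.Perm (Fin n), ∑ π : Fin m ↪ Fin n, g (ι.trans (π.trans σ.toEmbedding)) =
      ∑ π : Fin m ↪ Fin n, g (ι.trans π) := fun σ =>
    ((Equiv.refl (Fin m)).embeddingCongr σ).sum_comp (fun π : Fin m ↪ Fin n => g (ι.trans π))
  calc _ = ∑ σ : Equiv.Perm (Fin n), ∑ π : Fin m ↪ Fin n,
        g (ι.trans (π.trans σ.toEmbedding)) := by simp [h1]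
    _ = ∑ π : Fin m ↪ Fin n, ∑ σ : Equiv.Perm (Fin n), g ((ι.trans π).trans σ.toEmbedding) :=
        Finset.sum_comm
    _ = ∑ _π : Fin m ↪ Fin n, ∑ σ : Equiv.Perm (Fin n), g (ρ.trans σ.toEmbedding) :=
        Finset.sum_congr rfl fun π _ => sum_perm_trans_eq g _ _
    _ = _ := by simp

/-- The restriction of a uniformly random embedding is a uniformly random embedding. -/
theorem average_embedding_comp {m s n : ℕ} (hmn : m ≤ n) (ι : Fin s ↪ Fin m)
    (g : (Fin s ↪ Fin n) → ℝ) :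
    (Fintype.card (Fin m ↪ Fin n) : ℝ)⁻¹ * ∑ π : Fin m ↪ Fin n, g (ι.trans π) =
      (Fintype.card (Fin s ↪ Fin n) : ℝ)⁻¹ * ∑ ρ : Fin s ↪ Fin n, g ρ := by
  have hs : s ≤ m := by simpa using Fintype.card_le_of_embedding ι
  have ρ₀ : Fin s ↪ Fin n := ι.trans (Fin.castLEEmb hmn)
  have h1 := card_perm_mul_sum_embedding ι g ρ₀
  -- With the identity in place of ι, the same permutation sum also expresses the average over
  -- embeddings of `Fin s`.
  have h2 := card_perm_mul_sum_embedding (Function.Embedding.refl (Fin s)) g ρ₀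
  have c1 : (Fintype.card (Equiv.Perm (Fin n)) : ℝ) ≠ 0 :=
    Nat.cast_ne_zero.2 Fintype.card_ne_zero
  have c2 : (Fintype.card (Fin m ↪ Fin n) : ℝ) ≠ 0 :=
    Nat.cast_ne_zero.2 (card_embedding_ne_zero hmn)
  have c3 : (Fintype.card (Fin s ↪ Fin n) : ℝ) ≠ 0 :=
    Nat.cast_ne_zero.2 (card_embedding_ne_zero (hs.trans hmn))
  have h2' : (Fintype.card (Equiv.Perm (Fin n)) : ℝ) * ∑ ρ : Fin s ↪ Fin n, g ρ =
      Fintype.card (Fin s ↪ Fin n) * ∑ σ : Equiv.Perm (Fin n), g (ρ₀.trans σ.toEmbedding) := h2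
  refine mul_left_cancel₀ c1 ?_
  rw [mul_left_comm, h1, inv_mul_cancel_left₀ c2,
    mul_left_comm (Fintype.card (Equiv.Perm (Fin n)) : ℝ), h2', inv_mul_cancel_left₀ c3]

end Averaging

/-! ### Orthogonal expansion of the likelihood ratio -/

section Monomials

variable {𝒳 𝒴 : Type*}

/-- The product of the kernel values at the pairs of entries that are matched by two
embeddings. -/
noncomputable def kernelMonomial (K : 𝒳 × 𝒴 → ℝ) {n m s : ℕ} (ρ : Fin s ↪ Fin n)
    (ι : Fin s ↪ Fin m) (d : (Fin n → 𝒳) × (Fin m → 𝒴)) : ℝ :=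
  ∏ k, K (d.1 (ρ k), d.2 (ι k))

theorem kernelMonomial_update_left (K : 𝒳 × 𝒴 → ℝ) {n m s : ℕ} (ρ : Fin s ↪ Fin n)
    (ι : Fin s ↪ Fin m) (d : (Fin n → 𝒳) × (Fin m → 𝒴)) (k : Fin s) (u : 𝒳) :
    kernelMonomial K ρ ι (Function.update d.1 (ρ k) u, d.2) =
      K (u, d.2 (ι k)) * ∏ l ∈ Finset.univ.erase k, K (d.1 (ρ l), d.2 (ι l)) := by
  rw [kernelMonomial, ← Finset.mul_prod_erase _ _ (Finset.mem_univ k)]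
  congr 1
  · simp
  · refine Finset.prod_congr rfl fun l hl => ?_
    simp [Function.update_of_ne (ρ.injective.ne (Finset.ne_of_mem_erase hl))]

theorem kernelMonomial_update_right (K : 𝒳 × 𝒴 → ℝ) {n m s : ℕ} (ρ : Fin s ↪ Fin n)
    (ι : Fin s ↪ Fin m) (d : (Fin n → 𝒳) × (Fin m → 𝒴)) (k : Fin s) (t : 𝒴) :
    kernelMonomial K ρ ι (d.1, Function.update d.2 (ι k) t) =
      K (d.1 (ρ k), t) * ∏ l ∈ Finset.univ.erase k, K (d.1 (ρ l), d.2 (ι l)) := by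
  rw [kernelMonomial, ← Finset.mul_prod_erase _ _ (Finset.mem_univ k)]
  congr 1
  · simp
  · refine Finset.prod_congr rfl fun l hl => ?_
    simp [Function.update_of_ne (ι.injective.ne (Finset.ne_of_mem_erase hl))]

/-- The sum of all monomials with a given embedding of the `Y`-indices. -/
noncomputable def monomialSum (K : 𝒳 × 𝒴 → ℝ) (n : ℕ) {m s : ℕ} (ι : Fin s ↪ Fin m)
    (d : (Fin n → 𝒳) × (Fin m → 𝒴)) : ℝ :=
  ∑ ρ : Fin s ↪ Fin n, kernelMonomial K ρ ι d

/-- The likelihood ratio of the mixture: the average over all embeddings of the products of the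
densities of the matched pairs. -/
noncomputable def likelihoodRatio (K : 𝒳 × 𝒴 → ℝ) (n m : ℕ)
    (d : (Fin n → 𝒳) × (Fin m → 𝒴)) : ℝ :=
  (Fintype.card (Fin m ↪ Fin n) : ℝ)⁻¹ * ∑ π : Fin m ↪ Fin n, ∏ i, (1 + K (d.1 (π i), d.2 i))

/-- The increasing enumeration of a finite set of indices. -/
noncomputable def enumeration {m : ℕ} (S : Finset (Fin m)) : Fin S.card ↪ Fin m :=
  (S.orderEmbOfFin rfl).toEmbedding

theorem prod_enumeration {m : ℕ} (S : Finset (Fin m)) (f : Fin m → ℝ) :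
    ∏ i ∈ S, f i = ∏ k, f (enumeration S k) := by
  conv_lhs => rw [← S.map_orderEmbOfFin_univ rfl, Finset.prod_map]
  rfl

theorem likelihoodRatio_nonneg {K : 𝒳 × 𝒴 → ℝ} (hK0 : ∀ z, 0 ≤ 1 + K z) (n m : ℕ)
    (d : (Fin n → 𝒳) × (Fin m → 𝒴)) : 0 ≤ likelihoodRatio K n m d :=
  mul_nonneg (by positivity) (Finset.sum_nonneg fun π _ => Finset.prod_nonneg fun i _ => hK0 _)

/-- Multiply out ∏ (1 + K): the term of a subset S depends on π only through its restriction to S,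
which is again uniform. -/
theorem likelihoodRatio_eq_sum (K : 𝒳 × 𝒴 → ℝ) {n m : ℕ} (hmn : m ≤ n)
    (d : (Fin n → 𝒳) × (Fin m → 𝒴)) :
    likelihoodRatio K n m d = ∑ S : Finset (Fin m),
      (Fintype.card (Fin S.card ↪ Fin n) : ℝ)⁻¹ * monomialSum K n (enumeration S) d := by
  simp_rw [likelihoodRatio, Finset.prod_one_add, Finset.powerset_univ]
  rw [Finset.sum_comm, Finset.mul_sum]
  refine Finset.sum_congr rfl fun S _ => ?_
  rw [monomialSum, ← average_embedding_comp hmn (enumeration S)]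
  congr 1
  refine Finset.sum_congr rfl fun π _ => ?_
  rw [prod_enumeration]
  rfl

variable [MeasurableSpace 𝒳] [MeasurableSpace 𝒴]
  {μ : Measure 𝒳} {ν : Measure 𝒴} [IsProbabilityMeasure μ] [IsProbabilityMeasure ν]
  {K : 𝒳 × 𝒴 → ℝ}

theorem memLp_kernelMonomial (hK : Measurable K) (hK2 : MemLp K 2 (μ.prod ν)) {n m s : ℕ}
    (ρ : Fin s ↪ Fin n) (ι : Fin s ↪ Fin m) :
    MemLp (kernelMonomial K ρ ι) 2 (indepLaw (Fin n) (Fin m) μ ν) :=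
  memLp_prod_kernel hK hK2 ρ.injective ι.injective

/-- An X-entry that occurs in one monomial only is integrated out by the centering of K. -/
theorem integral_kernelMonomial_mul_eq_zero_left (hX : ∀ y, ∫ x, K (x, y) ∂μ = 0)
    {n m s s' : ℕ} (ρ : Fin s ↪ Fin n) (ι : Fin s ↪ Fin m) (ρ' : Fin s' ↪ Fin n)
    (ι' : Fin s' ↪ Fin m) {k : Fin s} (hk : ∀ l, ρ' l ≠ ρ k) :
    ∫ d, kernelMonomial K ρ ι d * kernelMonomial K ρ' ι' d ∂(indepLaw (Fin n) (Fin m) μ ν) = 0 := by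
  refine integral_indepLaw_eq_zero_left μ ν (ρ k) fun d => ?_
  have h : ∀ u, kernelMonomial K ρ' ι' (Function.update d.1 (ρ k) u, d.2) =
      kernelMonomial K ρ' ι' d := fun u => by
    simp [kernelMonomial, Function.update_of_ne (hk _)]
  simp_rw [h, kernelMonomial_update_left, integral_mul_const, hX, zero_mul]

theorem integral_kernelMonomial_mul_eq_zero_right (hY : ∀ x, ∫ y, K (x, y) ∂ν = 0)
    {n m s s' : ℕ} (ρ : Fin s ↪ Fin n) (ι : Fin s ↪ Fin m) (ρ' : Fin s' ↪ Fin n)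
    (ι' : Fin s' ↪ Fin m) {k : Fin s} (hk : ∀ l, ι' l ≠ ι k) :
    ∫ d, kernelMonomial K ρ ι d * kernelMonomial K ρ' ι' d ∂(indepLaw (Fin n) (Fin m) μ ν) = 0 := by
  refine integral_indepLaw_eq_zero_right μ ν (ι k) fun d => ?_
  have h : ∀ t, kernelMonomial K ρ' ι' (d.1, Function.update d.2 (ι k) t) =
      kernelMonomial K ρ' ι' d := fun t => by
    simp [kernelMonomial, Function.update_of_ne (hk _)]
  simp_rw [h, kernelMonomial_update_right, integral_mul_const, hY, zero_mul]

/-- The permanent is invariant under permuting the X-entries, and so is their law; hence all s!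
terms of the permanent have the same inner product with it. -/
theorem integral_perm_mul_kernelPermanent (hK : Measurable K) (hK2 : MemLp K 2 (μ.prod ν))
    (s : ℕ) :
    s.factorial * ∫ d, (∏ k, K (d.1 k, d.2 k)) * kernelPermanent K s d
      ∂(indepLaw (Fin s) (Fin s) μ ν) =
    ∫ d, kernelPermanent K s d ^ 2 ∂(indepLaw (Fin s) (Fin s) μ ν) := by
  have hD := memLp_kernelPermanent hK hK2 s
  have hterm : ∀ σ : Equiv.Perm (Fin s),
      MemLp (fun d : (Fin s → 𝒳) × (Fin s → 𝒴) => ∏ k, K (d.1 (σ k), d.2 k)) 2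
        (indepLaw (Fin s) (Fin s) μ ν) := fun σ =>
    memLp_prod_kernel hK hK2 σ.injective Function.injective_id
  have hσ : ∀ σ : Equiv.Perm (Fin s),
      ∫ d, (∏ k, K (d.1 (σ k), d.2 k)) * kernelPermanent K s d ∂(indepLaw (Fin s) (Fin s) μ ν) =
      ∫ d, (∏ k, K (d.1 k, d.2 k)) * kernelPermanent K s d ∂(indepLaw (Fin s) (Fin s) μ ν) := by
    intro σ
    have mp := measurePreserving_comp_indepLaw (κ := Fin s) μ ν σ.injective
      Function.injective_id
    have h1 := hterm 1
    rw [← integral_comp_of_measurePreserving mp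
      (f := fun d => (∏ k, K (d.1 k, d.2 k)) * kernelPermanent K s d)
      (h1.integrable_mul hD).aestronglyMeasurable]
    refine integral_congr_ae (ae_of_all _ fun d => ?_)
    have hinv : kernelPermanent K s (d.1 ∘ σ, d.2 ∘ id) = kernelPermanent K s d := by
      exact Equiv.sum_comp (Equiv.mulLeft σ) fun τ => ∏ i, K (d.1 (τ i), d.2 i)
    simp only [hinv]
    rfl
  have hsq : ∀ d : (Fin s → 𝒳) × (Fin s → 𝒴), kernelPermanent K s d ^ 2 =
      ∑ σ : Equiv.Perm (Fin s), (∏ k, K (d.1 (σ k), d.2 k)) * kernelPermanent K s d := fun d => by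
    rw [← Finset.sum_mul, pow_two]; rfl
  have hi : ∀ σ : Equiv.Perm (Fin s), Integrable (fun d : (Fin s → 𝒳) × (Fin s → 𝒴) =>
      (∏ k, K (d.1 (σ k), d.2 k)) * kernelPermanent K s d) (indepLaw (Fin s) (Fin s) μ ν) :=
    fun σ => (hterm σ).integrable_mul hD
  simp_rw [hsq]
  rw [integral_finsetSum _ fun σ _ => hi σ]
  simp_rw [hσ]
  rw [Finset.sum_const, Finset.card_univ, Fintype.card_perm, Fintype.card_fin, nsmul_eq_mul]

/-- Monomials of ρ and ρ' are orthogonal unless the ranges agree, that is, unless ρ' is ρ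
precomposed with a permutation. For fixed ρ these ρ' add up to the permanent of the selected
entries. -/
theorem integral_monomialSum_sq (hK : Measurable K) (hK2 : MemLp K 2 (μ.prod ν))
    (hX : ∀ y, ∫ x, K (x, y) ∂μ = 0) (n : ℕ) {m s : ℕ} (ι : Fin s ↪ Fin m) :
    s.factorial * ∫ d, monomialSum K n ι d ^ 2 ∂(indepLaw (Fin n) (Fin m) μ ν) =
      Fintype.card (Fin s ↪ Fin n) *
        ∫ d, kernelPermanent K s d ^ 2 ∂(indepLaw (Fin s) (Fin s) μ ν) := by
  have hint : ∀ ρ ρ' : Fin s ↪ Fin n, Integrable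
      (fun d => kernelMonomial K ρ ι d * kernelMonomial K ρ' ι d)
      (indepLaw (Fin n) (Fin m) μ ν) := fun ρ ρ' =>
    (memLp_kernelMonomial hK hK2 ρ ι).integrable_mul (memLp_kernelMonomial hK hK2 ρ' ι)
  have hrow : ∀ ρ : Fin s ↪ Fin n,
      ∑ ρ' : Fin s ↪ Fin n, ∫ d, kernelMonomial K ρ ι d * kernelMonomial K ρ' ι d
        ∂(indepLaw (Fin n) (Fin m) μ ν) =
      ∫ d, (∏ k, K (d.1 k, d.2 k)) * kernelPermanent K s d
        ∂(indepLaw (Fin s) (Fin s) μ ν) := by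
    intro ρ
    have hinj : Function.Injective
        (fun τ : Equiv.Perm (Fin s) => τ.toEmbedding.trans ρ) := fun τ τ' h => by
      refine Equiv.ext fun k => ?_
      simpa using DFunLike.congr_fun h k
    rw [← Fintype.sum_of_injective _ hinj (fun τ => ∫ d, kernelMonomial K ρ ι d *
        kernelMonomial K (τ.toEmbedding.trans ρ) ι d ∂(indepLaw (Fin n) (Fin m) μ ν)) _ ?_
        fun τ => rfl]
    · have mp := measurePreserving_comp_indepLaw μ ν ρ.injective ι.injective
      have hterm : ∀ τ : Equiv.Perm (Fin s), Integrable
          (fun d : (Fin s → 𝒳) × (Fin s → 𝒴) => (∏ k, K (d.1 k, d.2 k)) *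
            ∏ k, K (d.1 (τ k), d.2 k)) (indepLaw (Fin s) (Fin s) μ ν) := fun τ =>
        (memLp_prod_kernel hK hK2 Function.injective_id Function.injective_id).integrable_mul
          (memLp_prod_kernel hK hK2 τ.injective Function.injective_id)
      unfold kernelPermanent
      simp_rw [Finset.mul_sum]
      rw [integral_finsetSum _ fun τ _ => hterm τ]
      refine Finset.sum_congr rfl fun τ _ => ?_
      exact integral_comp_of_measurePreserving mp (hterm τ).aestronglyMeasurable
    · intro ρ' hρ'
      by_cases hex : ∃ k, ∀ l, ρ l ≠ ρ' k
      · obtain ⟨k, hk⟩ := hex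
        simp_rw [mul_comm (kernelMonomial K ρ ι _)]
        exact integral_kernelMonomial_mul_eq_zero_left hX ρ' ι ρ ι hk
      · exfalso
        push Not at hex
        choose τ hτ using hex
        have hτi : Function.Injective τ := fun a b hab => ρ'.injective (by
          rw [← hτ a, ← hτ b, hab])
        refine hρ' ⟨Equiv.ofBijective τ (Finite.injective_iff_bijective.1 hτi), ?_⟩
        ext k
        simp [hτ k]
  have hsq : ∫ d, monomialSum K n ι d ^ 2 ∂(indepLaw (Fin n) (Fin m) μ ν) =
      ∑ ρ : Fin s ↪ Fin n, ∑ ρ' : Fin s ↪ Fin n,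
        ∫ d, kernelMonomial K ρ ι d * kernelMonomial K ρ' ι d
          ∂(indepLaw (Fin n) (Fin m) μ ν) := by
    simp_rw [monomialSum, pow_two, Finset.sum_mul_sum]
    rw [integral_finsetSum _ fun j _ => integrable_finsetSum _ fun k _ => hint j k]
    exact Finset.sum_congr rfl fun j _ => integral_finsetSum _ fun k _ => hint j k
  rw [hsq]
  simp_rw [hrow]
  rw [Finset.sum_const, Finset.card_univ, nsmul_eq_mul, mul_left_comm,
    integral_perm_mul_kernelPermanent hK hK2]

theorem memLp_monomialSum (hK : Measurable K) (hK2 : MemLp K 2 (μ.prod ν)) (n : ℕ) {m s : ℕ}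
    (ι : Fin s ↪ Fin m) : MemLp (monomialSum K n ι) 2 (indepLaw (Fin n) (Fin m) μ ν) := by
  unfold monomialSum
  exact memLp_finsetSum _ fun ρ _ => memLp_kernelMonomial hK hK2 ρ ι

theorem integral_monomialSum_mul_eq_zero (hK : Measurable K) (hK2 : MemLp K 2 (μ.prod ν))
    (hY : ∀ x, ∫ y, K (x, y) ∂ν = 0) (n : ℕ) {m s s' : ℕ} (ι : Fin s ↪ Fin m)
    (ι' : Fin s' ↪ Fin m) {k : Fin s} (hk : ∀ l, ι' l ≠ ι k) :
    ∫ d, monomialSum K n ι d * monomialSum K n ι' d ∂(indepLaw (Fin n) (Fin m) μ ν) = 0 := by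
  have hint : ∀ (ρ : Fin s ↪ Fin n) (ρ' : Fin s' ↪ Fin n), Integrable
      (fun d => kernelMonomial K ρ ι d * kernelMonomial K ρ' ι' d)
      (indepLaw (Fin n) (Fin m) μ ν) := fun ρ ρ' =>
    (memLp_kernelMonomial hK hK2 ρ ι).integrable_mul (memLp_kernelMonomial hK hK2 ρ' ι')
  simp_rw [monomialSum, Finset.sum_mul_sum]
  rw [integral_finsetSum _ fun j _ => integrable_finsetSum _ fun k _ => hint j k]
  refine Finset.sum_eq_zero fun ρ _ => ?_
  rw [integral_finsetSum _ fun k _ => hint ρ k]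
  exact Finset.sum_eq_zero fun ρ' _ => integral_kernelMonomial_mul_eq_zero_right hY ρ ι ρ' ι' hk

theorem memLp_likelihoodRatio (hK : Measurable K) (hK2 : MemLp K 2 (μ.prod ν)) {n m : ℕ}
    (hmn : m ≤ n) : MemLp (likelihoodRatio K n m) 2 (indepLaw (Fin n) (Fin m) μ ν) := by
  have : likelihoodRatio K n m = fun d => ∑ S : Finset (Fin m),
      (Fintype.card (Fin S.card ↪ Fin n) : ℝ)⁻¹ * monomialSum K n (enumeration S) d :=
    funext fun d => likelihoodRatio_eq_sum K hmn d
  rw [this]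
  exact memLp_finsetSum _ fun S _ => (memLp_monomialSum hK hK2 n _).const_mul _

theorem exists_enumeration_ne {m : ℕ} {S S' : Finset (Fin m)} (h : ¬ S ⊆ S') :
    ∃ k, ∀ l, enumeration S' l ≠ enumeration S k := by
  obtain ⟨i, hi, hi'⟩ := Finset.not_subset.1 h
  have : i ∈ Set.range (S.orderEmbOfFin rfl) := by rw [Finset.range_orderEmbOfFin]; exact hi
  obtain ⟨k, rfl⟩ := this
  refine ⟨k, fun l hl => hi' ?_⟩
  change S'.orderEmbOfFin rfl l = S.orderEmbOfFin rfl k at hl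
  rw [← hl]
  exact S'.orderEmbOfFin_mem rfl l

/-- The second moment of the likelihood ratio. -/
theorem integral_likelihoodRatio_sq (hK : Measurable K) (hK2 : MemLp K 2 (μ.prod ν))
    (hX : ∀ y, ∫ x, K (x, y) ∂μ = 0) (hY : ∀ x, ∫ y, K (x, y) ∂ν = 0) {n m : ℕ}
    (hmn : m ≤ n) :
    ∫ d, likelihoodRatio K n m d ^ 2 ∂(indepLaw (Fin n) (Fin m) μ ν) =
      ∑ s ∈ Finset.range (m + 1), (m.choose s : ℝ) * ((n.descFactorial s : ℝ)⁻¹ *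
        ((s.factorial : ℝ)⁻¹ *
          ∫ d, kernelPermanent K s d ^ 2 ∂(indepLaw (Fin s) (Fin s) μ ν))) := by
  set c : Finset (Fin m) → ℝ := fun S => (Fintype.card (Fin S.card ↪ Fin n) : ℝ)⁻¹ with hc
  have hint : ∀ S S' : Finset (Fin m), Integrable (fun d =>
      c S * monomialSum K n (enumeration S) d * (c S' * monomialSum K n (enumeration S') d))
      (indepLaw (Fin n) (Fin m) μ ν) := fun S S' =>
    ((memLp_monomialSum hK hK2 n _).const_mul _).integrable_mul
      ((memLp_monomialSum hK hK2 n _).const_mul _)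
  have hmul : ∀ (S S' : Finset (Fin m)) (d : (Fin n → 𝒳) × (Fin m → 𝒴)),
      c S * monomialSum K n (enumeration S) d * (c S' * monomialSum K n (enumeration S') d) =
      c S * c S' * (monomialSum K n (enumeration S) d * monomialSum K n (enumeration S') d) :=
    fun S S' d => mul_mul_mul_comm _ _ _ _
  -- Of two distinct sets one has an element outside the other; integrating out that Y-entry gives
  -- zero.
  have hoff : ∀ S S' : Finset (Fin m), S' ≠ S →
      ∫ d, c S * monomialSum K n (enumeration S) d * (c S' * monomialSum K n (enumeration S') d)
        ∂(indepLaw (Fin n) (Fin m) μ ν) = 0 := by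
    intro S S' hne
    simp_rw [hmul S S']
    rw [integral_const_mul]
    by_cases h : S ⊆ S'
    · obtain ⟨k, hk⟩ := exists_enumeration_ne fun h' => hne (h'.antisymm h)
      simp_rw [mul_comm (monomialSum K n (enumeration S) _)]
      rw [integral_monomialSum_mul_eq_zero hK hK2 hY n _ _ hk, mul_zero]
    · obtain ⟨k, hk⟩ := exists_enumeration_ne h
      rw [integral_monomialSum_mul_eq_zero hK hK2 hY n _ _ hk, mul_zero]
  have hdiag : ∀ S : Finset (Fin m),
      ∫ d, c S * monomialSum K n (enumeration S) d * (c S * monomialSum K n (enumeration S) d)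
        ∂(indepLaw (Fin n) (Fin m) μ ν) =
      (n.descFactorial S.card : ℝ)⁻¹ * ((S.card.factorial : ℝ)⁻¹ *
        ∫ d, kernelPermanent K S.card d ^ 2 ∂(indepLaw (Fin S.card) (Fin S.card) μ ν)) := by
    intro S
    have h := integral_monomialSum_sq hK hK2 hX n (enumeration S)
    have hs : S.card ≤ n := (by simpa using S.card_le_univ : S.card ≤ m).trans hmn
    have h1 : (Fintype.card (Fin S.card ↪ Fin n) : ℝ) ≠ 0 :=
      Nat.cast_ne_zero.2 (card_embedding_ne_zero hs)
    have h2 : (S.card.factorial : ℝ) ≠ 0 := Nat.cast_ne_zero.2 (Nat.factorial_ne_zero _)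
    have h3 : n.descFactorial S.card = Fintype.card (Fin S.card ↪ Fin n) := by
      rw [Fintype.card_embedding_eq, Fintype.card_fin, Fintype.card_fin]
    simp_rw [hmul S S]
    rw [integral_const_mul, h3]
    simp_rw [← pow_two]
    rw [← eq_inv_mul_iff_mul_eq₀ h2] at h
    rw [h, hc]
    field_simp
  calc ∫ d, likelihoodRatio K n m d ^ 2 ∂(indepLaw (Fin n) (Fin m) μ ν)
      = ∑ S : Finset (Fin m), ∑ S' : Finset (Fin m),
        ∫ d, c S * monomialSum K n (enumeration S) d *
          (c S' * monomialSum K n (enumeration S') d) ∂(indepLaw (Fin n) (Fin m) μ ν) := by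
        simp_rw [likelihoodRatio_eq_sum K hmn, pow_two, Finset.sum_mul_sum]
        rw [integral_finsetSum _ fun j _ => integrable_finsetSum _ fun k _ => hint j k]
        exact Finset.sum_congr rfl fun j _ => integral_finsetSum _ fun k _ => hint j k
    _ = ∑ S : Finset (Fin m), (n.descFactorial S.card : ℝ)⁻¹ * ((S.card.factorial : ℝ)⁻¹ *
          ∫ d, kernelPermanent K S.card d ^ 2 ∂(indepLaw (Fin S.card) (Fin S.card) μ ν)) := by
        refine Finset.sum_congr rfl fun S _ => ?_
        rw [← hdiag S]
        exact Fintype.sum_eq_single S fun S' hS' => hoff S S' hS'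
    _ = _ := by
        have h := Finset.sum_powerset_apply_card (fun s => (n.descFactorial s : ℝ)⁻¹ *
          ((s.factorial : ℝ)⁻¹ * ∫ d, kernelPermanent K s d ^ 2 ∂(indepLaw (Fin s) (Fin s) μ ν)))
          (x := (Finset.univ : Finset (Fin m)))
        rw [Finset.powerset_univ, Finset.card_univ, Fintype.card_fin] at h
        simpa only [nsmul_eq_mul] using h

end Monomials

/-! ### A bound on the second moment uniform in the sample size -/

section SecondMoment

theorem descFactorial_le_pow_mul {m n : ℕ} {β : ℝ} (hβ0 : 0 ≤ β) (hβ1 : β ≤ 1) (hmn : m ≤ n)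
    (h : (m : ℝ) ≤ β * n) (s : ℕ) :
    (m.descFactorial s : ℝ) ≤ β ^ s * n.descFactorial s := by
  induction s with
  | zero => simp
  | succ s ih =>
    have h1 : ((m - s : ℕ) : ℝ) ≤ β * ((n - s : ℕ) : ℝ) := by
      rcases le_total m s with hs | hs
      · rw [Nat.sub_eq_zero_of_le hs, Nat.cast_zero]; positivity
      · rw [Nat.cast_sub hs, Nat.cast_sub (hs.trans hmn)]
        nlinarith [(Nat.cast_nonneg s : (0 : ℝ) ≤ s)]
    rw [Nat.descFactorial_succ, Nat.descFactorial_succ, Nat.cast_mul, Nat.cast_mul]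
    calc ((m - s : ℕ) : ℝ) * m.descFactorial s
        ≤ (β * ((n - s : ℕ) : ℝ)) * (β ^ s * n.descFactorial s) := by gcongr
      _ = _ := by ring

/-- The terms of the series that bounds the second moment of the likelihood ratio. -/
noncomputable def momentTerm (β r I : ℝ) (s : ℕ) : ℝ :=
  β ^ s * ((s.factorial : ℝ)⁻¹ * ∏ i ∈ Finset.range s, (I + r * i))

theorem momentTerm_nonneg {β r I : ℝ} (hβ : 0 ≤ β) (hr : 0 ≤ r) (hI : 0 ≤ I) (s : ℕ) :
    0 ≤ momentTerm β r I s :=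
  mul_nonneg (by positivity) (mul_nonneg (by positivity) (Finset.prod_nonneg fun i _ => by positivity))

/-- Successive ratios are β(I + rs)/(s + 1), with limit βr; positivity of I keeps the terms nonzero.
For r > 0 this is the binomial series of (1 - βr)^(-I/r). -/
theorem summable_momentTerm {β r I : ℝ} (hβ : 0 < β) (hr : 0 ≤ r) (hI : 0 < I)
    (h : β * r < 1) : Summable (momentTerm β r I) := by
  have hpos : ∀ s, 0 < momentTerm β r I s := fun s =>
    mul_pos (by positivity) (mul_pos (by positivity) (Finset.prod_pos fun i _ => by positivity))
  refine summable_of_ratio_test_tendsto_lt_one h (Eventually.of_forall fun s => (hpos s).ne') ?_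
  have hratio : ∀ s : ℕ, ‖momentTerm β r I (s + 1)‖ / ‖momentTerm β r I s‖ =
      β * r + β * (I - r) * (1 / ((s : ℝ) + 1)) := fun s => by
    rw [Real.norm_of_nonneg (hpos _).le, Real.norm_of_nonneg (hpos s).le,
      div_eq_iff (hpos s).ne', momentTerm, momentTerm, Finset.prod_range_succ,
      Nat.factorial_succ, pow_succ]
    push_cast
    have : (s.factorial : ℝ) ≠ 0 := Nat.cast_ne_zero.2 (Nat.factorial_ne_zero _)
    field_simp
    ring
  simp_rw [hratio]
  simpa using (tendsto_one_div_add_atTop_nhds_zero_nat (𝕜 := ℝ)).const_mul (β * (I - r)) |>.const_add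
    (β * r)

variable {𝒳 𝒴 : Type*} [MeasurableSpace 𝒳] [MeasurableSpace 𝒴]
  {μ : Measure 𝒳} {ν : Measure 𝒴} [IsProbabilityMeasure μ] [IsProbabilityMeasure ν]
  {K : 𝒳 × 𝒴 → ℝ}

/-- The weight of order s is (m)_s / (s! (n)_s) ≤ βˢ/s! in falling factorials, and the s! in the
permanent bound cancels the other factorial. Adding 1 to the second moment of K keeps the series
terms positive even if K vanishes. -/
theorem integral_likelihoodRatio_sq_le (hK : Measurable K) (hK2 : MemLp K 2 (μ.prod ν))
    (hX : ∀ y, ∫ x, K (x, y) ∂μ = 0) (hY : ∀ x, ∫ y, K (x, y) ∂ν = 0) {r β : ℝ}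
    (hr0 : 0 ≤ r) (hr : ∀ b : 𝒳 → ℝ, Measurable b → MemLp b 2 μ →
      ∫ y, (∫ x, K (x, y) * b x ∂μ) ^ 2 ∂ν ≤ r * ∫ x, b x ^ 2 ∂μ)
    (hβ0 : 0 < β) (hβ1 : β ≤ 1) (hβr : β * r < 1) {n m : ℕ} (hmn : m ≤ n)
    (h : (m : ℝ) ≤ β * n) :
    ∫ d, likelihoodRatio K n m d ^ 2 ∂(indepLaw (Fin n) (Fin m) μ ν) ≤
      ∑' s, momentTerm β r (∫ z, K z ^ 2 ∂(μ.prod ν) + 1) s := by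
  have hI : 0 ≤ ∫ z, K z ^ 2 ∂(μ.prod ν) := integral_nonneg fun z => sq_nonneg _
  refine le_trans ?_ ((summable_momentTerm hβ0 hr0 (by positivity) hβr).sum_le_tsum
    (Finset.range (m + 1)) fun s _ => momentTerm_nonneg hβ0.le hr0 (by positivity) s)
  rw [integral_likelihoodRatio_sq hK hK2 hX hY hmn]
  refine Finset.sum_le_sum fun s hs => ?_
  have hsn : s ≤ n := (Nat.lt_succ_iff.1 (Finset.mem_range.1 hs)).trans hmn
  have hd : (0 : ℝ) < n.descFactorial s := Nat.cast_pos.2 (Nat.descFactorial_pos.2 hsn)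
  have hf : (0 : ℝ) < s.factorial := Nat.cast_pos.2 s.factorial_pos
  have h1 := integral_kernelPermanent_sq_le hK hK2 hr0 hr s
  have h2 : (s.factorial : ℝ)⁻¹ *
      ∫ d, kernelPermanent K s d ^ 2 ∂(indepLaw (Fin s) (Fin s) μ ν) ≤
      ∏ i ∈ Finset.range s, (∫ z, K z ^ 2 ∂(μ.prod ν) + 1 + r * i) := by
    rw [inv_mul_le_iff₀ hf]
    refine h1.trans ?_
    gcongr with i
    linarith
  have h3 : (m.choose s : ℝ) = (s.factorial : ℝ)⁻¹ * m.descFactorial s := by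
    rw [Nat.descFactorial_eq_factorial_mul_choose, Nat.cast_mul, inv_mul_cancel_left₀ hf.ne']
  have h4 : (m.choose s : ℝ) * (n.descFactorial s : ℝ)⁻¹ ≤ β ^ s * (s.factorial : ℝ)⁻¹ := by
    rw [h3, ← div_eq_mul_inv, div_le_iff₀ hd]
    calc _ ≤ (s.factorial : ℝ)⁻¹ * (β ^ s * n.descFactorial s) := by
          gcongr; exact descFactorial_le_pow_mul hβ0.le hβ1 hmn h s
      _ = _ := by ring
  rw [momentTerm, ← mul_assoc, ← mul_assoc (β ^ s)]
  have h5 : 0 ≤ (s.factorial : ℝ)⁻¹ *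
      ∫ d, kernelPermanent K s d ^ 2 ∂(indepLaw (Fin s) (Fin s) μ ν) :=
    mul_nonneg (by positivity) (integral_nonneg fun d => sq_nonneg _)
  exact mul_le_mul h4 h2 h5 (by positivity)

end SecondMoment

/-! ### Likelihood ratios and the impossibility of strong detection -/

section Densities

theorem pi_withDensity {ι Ω : Type*} [Fintype ι] [MeasurableSpace Ω] (Q : Measure Ω)
    [IsProbabilityMeasure Q] {f : Ω → ℝ≥0∞} (hf : Measurable f)
    [IsProbabilityMeasure (Q.withDensity f)] :
    Measure.pi (fun _ : ι => Q.withDensity f) =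
      (Measure.pi fun _ : ι => Q).withDensity fun w => ∏ i, f (w i) := by
  classical
  refine Measure.pi_eq fun s hs => ?_
  have hind := ProbabilityTheory.iIndepFun_pi (μ := fun _ : ι => Q)
    (X := fun i => (s i).indicator f) fun i => (hf.indicator (hs i)).aemeasurable
  rw [withDensity_apply _ (MeasurableSet.univ_pi hs), ← lintegral_indicator (MeasurableSet.univ_pi hs)]
  have h1 : ((Set.univ.pi s).indicator fun w : ι → Ω => ∏ i, f (w i)) =
      fun w => ∏ i, (s i).indicator f (w i) := by
    funext w
    by_cases hw : w ∈ Set.univ.pi s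
    · rw [Set.indicator_of_mem hw]
      exact Finset.prod_congr rfl fun i _ => (Set.indicator_of_mem (hw i trivial) f).symm
    · rw [Set.indicator_of_notMem hw]
      obtain ⟨i, hi⟩ : ∃ i, w i ∉ s i := by simpa [Set.mem_pi] using hw
      exact (Finset.prod_eq_zero (Finset.mem_univ i) (Set.indicator_of_notMem hi f)).symm
  rw [h1, ProbabilityTheory.lintegral_prod_eq_prod_lintegral_of_indepFun Finset.univ _ hind
    fun i => (hf.indicator (hs i)).comp (measurable_pi_apply i)]
  refine Finset.prod_congr rfl fun i _ => ?_
  rw [withDensity_apply _ (hs i), ← lintegral_indicator (hs i)]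
  exact (measurePreserving_eval (fun _ : ι => Q) i).lintegral_comp (hf.indicator (hs i))

variable {𝒳 𝒴 : Type*} [MeasurableSpace 𝒳] [MeasurableSpace 𝒴]

/-- The two laws are images under `assemble π` of measures that differ only in the law of the
matched pairs, and the product density of these pairs can be read off from the assembled data. -/
theorem altLawGiven_eq_withDensity (P : Measure (𝒳 × 𝒴)) [IsProbabilityMeasure P]
    {f : 𝒳 × 𝒴 → ℝ≥0∞} (hf : Measurable f) (hP : P = (P.fst.prod P.snd).withDensity f)
    {n m : ℕ} (π : Fin m ↪ Fin n) :
    altLawGiven P π = (nullLaw P n m).withDensity fun d => ∏ i, f (d.1 (π i), d.2 i) := by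
  have : IsProbabilityMeasure ((P.fst.prod P.snd).withDensity f) := by rw [← hP]; infer_instance
  have hg : Measurable fun d : (Fin n → 𝒳) × (Fin m → 𝒴) => ∏ i, f (d.1 (π i), d.2 i) := by
    fun_prop
  have hF : Measurable fun w : Fin m → 𝒳 × 𝒴 => ∏ i, f (w i) := by fun_prop
  have hpi : (Measure.pi fun _ : Fin m => P) =
      (Measure.pi fun _ : Fin m => P.fst.prod P.snd).withDensity fun w => ∏ i, f (w i) := by
    rw [← pi_withDensity _ hf, ← hP]
  ext A hA
  rw [withDensity_apply _ hA, ← altLawGiven_prod_eq_nullLaw P π, altLawGiven, altLawGiven,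
    setLIntegral_map hA hg (measurable_assemble π), Measure.map_apply (measurable_assemble π) hA,
    hpi, prod_withDensity_left hF, withDensity_apply _ (measurable_assemble π hA),
    Measure.fst_prod]
  refine lintegral_congr fun w => Finset.prod_congr rfl fun i _ => ?_
  rw [assemble_fst_apply]
  rfl

theorem altLaw_eq_withDensity (P : Measure (𝒳 × 𝒴)) [IsProbabilityMeasure P]
    {K : 𝒳 × 𝒴 → ℝ} (hK : Measurable K) (hK0 : ∀ z, 0 ≤ 1 + K z)
    (hP : P = (P.fst.prod P.snd).withDensity fun z => ENNReal.ofReal (1 + K z))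
    {n m : ℕ} (hmn : m ≤ n) :
    altLaw P n m =
      (nullLaw P n m).withDensity fun d => ENNReal.ofReal (likelihoodRatio K n m d) := by
  have hf : Measurable fun z => ENNReal.ofReal (1 + K z) := by fun_prop
  have hg : ∀ π : Fin m ↪ Fin n, Measurable fun d : (Fin n → 𝒳) × (Fin m → 𝒴) =>
      ∏ i, ENNReal.ofReal (1 + K (d.1 (π i), d.2 i)) := fun π => by fun_prop
  have hc : (0 : ℝ) < Fintype.card (Fin m ↪ Fin n) :=
    Nat.cast_pos.2 (Nat.pos_of_ne_zero (card_embedding_ne_zero hmn))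
  have hΛ : ∀ d : (Fin n → 𝒳) × (Fin m → 𝒴), ENNReal.ofReal (likelihoodRatio K n m d) =
      (Fintype.card (Fin m ↪ Fin n) : ℝ≥0∞)⁻¹ *
        ∑ π : Fin m ↪ Fin n, ∏ i, ENNReal.ofReal (1 + K (d.1 (π i), d.2 i)) := fun d => by
    rw [likelihoodRatio, ENNReal.ofReal_mul (by positivity), ENNReal.ofReal_inv_of_pos hc,
      ENNReal.ofReal_natCast, ENNReal.ofReal_sum_of_nonneg fun π _ =>
        Finset.prod_nonneg fun i _ => hK0 _]
    congr 1
    exact Finset.sum_congr rfl fun π _ => ENNReal.ofReal_prod_of_nonneg fun i _ => hK0 _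
  ext A hA
  rw [withDensity_apply _ hA, altLaw, Measure.smul_apply, Measure.finsetSum_apply, smul_eq_mul]
  simp_rw [hΛ]
  rw [lintegral_const_mul _ (Finset.measurable_sum _ fun π _ => hg π),
    lintegral_finsetSum _ fun π _ => hg π]
  congr 1
  refine Finset.sum_congr rfl fun π _ => ?_
  rw [altLawGiven_eq_withDensity P hf hP π, withDensity_apply _ hA]

/-- A bound on the second moment of the likelihood ratio makes the alternative law small on
events that are rare under the null law. -/
theorem altLaw_real_le (P : Measure (𝒳 × 𝒴)) [IsProbabilityMeasure P]
    {K : 𝒳 × 𝒴 → ℝ} (hK : Measurable K) (hK0 : ∀ z, 0 ≤ 1 + K z)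
    (hK2 : MemLp K 2 (P.fst.prod P.snd))
    (hP : P = (P.fst.prod P.snd).withDensity fun z => ENNReal.ofReal (1 + K z))
    {n m : ℕ} (hmn : m ≤ n) {A : Set ((Fin n → 𝒳) × (Fin m → 𝒴))} (hA : MeasurableSet A)
    {t : ℝ} (ht : 0 < t) :
    (altLaw P n m).real A ≤
      t * ∫ d, likelihoodRatio K n m d ^ 2 ∂(nullLaw P n m) + t⁻¹ * (nullLaw P n m).real A := by
  have hΛ : MemLp (likelihoodRatio K n m) 2 (nullLaw P n m) := memLp_likelihoodRatio hK hK2 hmn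
  have hΛ0 := likelihoodRatio_nonneg hK0 n m
  have hi := hΛ.integrable one_le_two
  have h1 : (altLaw P n m).real A = ∫ d in A, likelihoodRatio K n m d ∂(nullLaw P n m) := by
    rw [measureReal_def, altLaw_eq_withDensity P hK hK0 hP hmn, withDensity_apply _ hA,
      integral_eq_lintegral_of_nonneg_ae (ae_of_all _ hΛ0) hi.aestronglyMeasurable.restrict]
  -- A linearized Cauchy–Schwarz inequality with free parameter t.
  have hpt : ∀ x : ℝ, x ≤ t * x ^ 2 + t⁻¹ := fun x => by
    have h2 : 0 ≤ t * (x - t⁻¹ / 2) ^ 2 := by positivity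
    have h3 : t * (x - t⁻¹ / 2) ^ 2 = t * x ^ 2 - x + t⁻¹ / 4 := by field_simp; ring
    have h4 : 0 < t⁻¹ := inv_pos.2 ht
    linarith
  rw [h1]
  calc ∫ d in A, likelihoodRatio K n m d ∂(nullLaw P n m)
      ≤ ∫ d in A, (t * likelihoodRatio K n m d ^ 2 + t⁻¹) ∂(nullLaw P n m) :=
        setIntegral_mono hi.integrableOn
          ((hΛ.integrable_sq.const_mul t).add (integrable_const _)).integrableOn fun d => hpt _
    _ = t * ∫ d in A, likelihoodRatio K n m d ^ 2 ∂(nullLaw P n m) +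
        t⁻¹ * (nullLaw P n m).real A := by
        rw [integral_add (hΛ.integrable_sq.const_mul t).integrableOn (integrable_const _),
          integral_const_mul, setIntegral_const, smul_eq_mul, mul_comm t⁻¹]
    _ ≤ _ := by
        have h5 := setIntegral_le_integral (s := A) hΛ.integrable_sq
          (ae_of_all _ fun d => sq_nonneg (likelihoodRatio K n m d))
        gcongr

/-- If both errors vanished, the bound of `altLaw_real_le` on the rejection regions would give 1 ≤
tC in the limit, for every t > 0. -/
theorem not_strongDetection_of_integral_sq_le (P : Measure (𝒳 × 𝒴)) [IsProbabilityMeasure P]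
    {K : 𝒳 × 𝒴 → ℝ} (hK : Measurable K) (hK0 : ∀ z, 0 ≤ 1 + K z)
    (hK2 : MemLp K 2 (P.fst.prod P.snd))
    (hP : P = (P.fst.prod P.snd).withDensity fun z => ENNReal.ofReal (1 + K z))
    {n m : ℕ → ℕ} (hmn : ∀ k, m k ≤ n k) {C : ℝ}
    (hC : ∀ᶠ k in atTop,
      ∫ d, likelihoodRatio K (n k) (m k) d ^ 2 ∂(nullLaw P (n k) (m k)) ≤ C) :
    ¬ StrongDetection P n m := by
  rintro ⟨A, hA, h0, h1⟩
  obtain ⟨t, ht, htC⟩ : ∃ t : ℝ, 0 < t ∧ t * C < 1 := by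
    refine ⟨(|C| + 1)⁻¹, by positivity, ?_⟩
    rw [inv_mul_lt_iff₀ (by positivity)]
    linarith [le_abs_self C]
  have e0 : Tendsto (fun k => (nullLaw P (n k) (m k)).real (A k)) atTop (𝓝 0) :=
    (ENNReal.tendsto_toReal ENNReal.zero_ne_top).comp h0
  have e1 : Tendsto (fun k => (altLaw P (n k) (m k)).real (A k)ᶜ) atTop (𝓝 0) :=
    (ENNReal.tendsto_toReal ENNReal.zero_ne_top).comp h1
  have hle : ∀ᶠ k in atTop, 1 ≤ t * C + t⁻¹ * (nullLaw P (n k) (m k)).real (A k) +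
      (altLaw P (n k) (m k)).real (A k)ᶜ := by
    filter_upwards [hC] with k hk
    have := isProbabilityMeasure_altLaw P (hmn k)
    have h2 := altLaw_real_le P hK hK0 hK2 hP (hmn k) (hA k) ht
    have h3 := probReal_compl_eq_one_sub (μ := altLaw P (n k) (m k)) (hA k)
    have h4 := mul_le_mul_of_nonneg_left hk ht.le
    linarith
  have hlim := ((e0.const_mul t⁻¹).const_add (t * C)).add e1
  have := ge_of_tendsto hlim hle
  simp only [mul_zero, add_zero] at this
  linarith

/-- Strong detection fails when the chi-square information is finite and the product of the
asymptotic sampling ratio and the squared maximal correlation is below one. -/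
theorem not_strongDetection (P : Measure (𝒳 × 𝒴)) [IsProbabilityMeasure P]
    (hP : chiSqInfo P ≠ ∞) {n m : ℕ → ℕ} (hmn : ∀ k, m k ≤ n k) {β : ℝ} (hβ0 : 0 < β)
    (hβ1 : β ≤ 1) (hβ : β * max (maximalCorrelation P) 0 ^ 2 < 1)
    (hm : ∀ᶠ k in atTop, (m k : ℝ) ≤ β * n k) : ¬ StrongDetection P n m := by
  obtain ⟨K, hK, hK0, hK2, hX, hY, hPK⟩ := exists_centered_kernel P hP
  refine not_strongDetection_of_integral_sq_le P hK hK0 hK2 hPK hmn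
    (C := ∑' s, momentTerm β (max (maximalCorrelation P) 0 ^ 2)
      (∫ z, K z ^ 2 ∂(P.fst.prod P.snd) + 1) s) (hm.mono fun k hk => ?_)
  exact integral_likelihoodRatio_sq_le hK hK2 hX hY (sq_nonneg _)
    (fun b hb hb2 => integral_sq_integral_kernel_le P hK hK0 hK2 hX hY hPK hb hb2)
    hβ0 hβ1 hβ (hmn k) hk

end Densities

end BrokenSample

/-! ### The characterization of strong detection -/

/-- Sample sizes `n k → ∞` and `m k = α * n k` up to rounding to an integer
(so `m k ≤ n k`, and `m k = n k` if `α = 1`). -/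
theorem mainTheorem1 {𝒳 𝒴 : Type*} [MeasurableSpace 𝒳] [MeasurableSpace 𝒴]
    (P : Measure (𝒳 × 𝒴)) [IsProbabilityMeasure P]
    (α : ℝ) (hα_pos : 0 < α) (hα_le : α ≤ 1)
    (n m : ℕ → ℕ) (hn : Tendsto n atTop atTop)
    (hmn : ∀ k, m k ≤ n k) (hm : ∀ k, |(m k : ℝ) - α * (n k : ℝ)| < 1) :
    BrokenSample.StrongDetection P n m ↔
      (BrokenSample.chiSqInfo P = ∞ ∨ (α = 1 ∧ BrokenSample.maximalCorrelation P = 1)) := by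
  constructor
  · intro hdet
    by_contra hcon
    push Not at hcon
    obtain ⟨hI, hρ⟩ := hcon
    have hρ1 := BrokenSample.maximalCorrelation_le_one P
    have hmax : max (BrokenSample.maximalCorrelation P) 0 ≤ 1 := max_le hρ1 zero_le_one
    have hmax0 : 0 ≤ max (BrokenSample.maximalCorrelation P) 0 := le_max_right _ _
    rcases eq_or_lt_of_le hα_le with rfl | hα
    · have hlt : max (BrokenSample.maximalCorrelation P) 0 < 1 :=
        max_lt (lt_of_le_of_ne hρ1 (hρ rfl)) one_pos
      refine BrokenSample.not_strongDetection P hI hmn one_pos le_rfl ?_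
        (Eventually.of_forall fun k => ?_) hdet
      · rw [one_mul]; exact pow_lt_one₀ hmax0 hlt two_ne_zero
      · rw [one_mul]; exact_mod_cast hmn k
    -- Since ρ ≤ 1, any β < 1 is admissible. The midpoint of α and 1 absorbs the rounding: αn + 1 ≤
    -- βn as soon as n ≥ 2/(1 - α).
    · refine BrokenSample.not_strongDetection P hI hmn (β := (1 + α) / 2) (by linarith)
        (by linarith) ?_ ?_ hdet
      · have := pow_le_one₀ (n := 2) hmax0 hmax
        nlinarith
      · have hlarge := (tendsto_natCast_atTop_atTop (R := ℝ)).comp hn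
          |>.eventually_ge_atTop (2 / (1 - α))
        filter_upwards [hlarge] with k hk
        have h1 := (abs_lt.1 (hm k)).2
        rw [Function.comp_apply, div_le_iff₀ (by linarith)] at hk
        linarith
  · rintro (hI | ⟨rfl, hρ⟩)
    · exact BrokenSample.strongDetection_of_chiSqInfo_eq_top P hI hα_pos hn hmn hm
    -- For α = 1 the rounding error is below one, so n - 1 < m ≤ n.
    · obtain rfl : m = n := funext fun k => by
        have h1 := (abs_lt.1 (hm k)).1
        have h2 : (n k : ℝ) < m k + 1 := by linarith
        have h3 : n k < m k + 1 := by exact_mod_cast h2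
        have := hmn k
        omega
      exact BrokenSample.strongDetection_of_maximalCorrelation_eq_one P hρ hn
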